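/- Setting. For every $n\in\mathbb N$ let $(w_x^+)_{x\in[n]}$ and $(w_x^-)_{x\in[n]}$ be positive weights (which may depend on $n$) with $\sum_x w_x^+=\sum_x w_x^-=:\mathbf w$. Assume that there are constants $M_0,M_1>1$, $M_2>0$ and $\eta\in(0,1)$, independent of $n$, with $M_0\le w_x^+\le M_1$ for all $x\in[n]$ and $\sum_{x\in[n]}(w_x^-)^{2+\eta}\le M_2n$. Let $G$ be the random digraph on $[n]$ without loops in which the edges $x\to y$ ($x\ne y$) are present independently with probabilities $p_{xy}=\min\{w_x^+w_y^-\frac{\log n}{n},1\}$, and let $\mathbb P$ be its law. Let $D_x^+$ be the out-degree of $x$, and let $P(x,y)=1/D_x^+$ if $x\to y$ and $P(x,y)=0$ otherwise. A path of length $k$ is a sequence $\mathbf p=(x_0,\dots,x_k)$ with $x_i\to x_{i+1}$ for all $i<k$, and its mass is $\mathbf m(\mathbf p)=\prod_{i<k}P(x_i,x_{i+1})$. Put $$\mu_{\rm in}(x)=\frac{w_x^-}{\mathbf w},\qquad H=\sum_{x\in[n]}\mu_{\rm in}(x)\,\mathbb E[\log(D_x^+\vee1)],\qquad t_{\rm ent}=\frac{\log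 n}{H}.$$ Fix $\varepsilon\in(0,1)$, let $\gamma=\varepsilon/80$, and let $s=(1-\gamma)t_{\rm ent}$, $h=h_\varepsilon=\frac{\varepsilon\log n}{20H}$ (both replaced by their integer parts), and $t=s+h+1$. Roots. A vertex $x$ is an $h_\varepsilon$-root if its out-neighbourhood of radius $h$, that is, the subgraph formed by all paths of length at most $h$ starting at $x$, is a directed tree. Let $V_\varepsilon$ be the set of $h_\varepsilon$-roots. The tree $\mathcal T_x(s)$. Start from $\mathcal G^0=\mathcal T^0=\{x\}$. Given $\mathcal G^{\ell-1}$ and its spanning tree $\mathcal T^{\ell-1}$, consider the edges $e$ of $G$ not yet in $\mathcal G^{\ell-1}$ whose tail $v_e^-$ is a vertex of $\mathcal T^{\ell-1}$ at tree distance at most $s-1$ from $x$, and let $\hat{\mathbf m}(e)=\mathbf m(\mathbf p_{x,v_e^-})/D^+_{v_e^-}$, where $\mathbf p_{x,v_e^-}$ is the path from $x$ to $v_e^-$ in $\mathcal T^{\ell-1}$. If such an edge with $\hat{\mathbf m}(e)\ge e^{-(1+\gamma)Hs}$ exists, choose one of maximal $\hat{\mathbf m}(e)$ (ties being broken by any fixed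 deterministic rule, which selects an element of the set of maximizers and may depend on $n$ and $x$) and add it to $\mathcal G^{\ell-1}$ to obtain $\mathcal G^\ell$; add it to $\mathcal T^{\ell-1}$ as well if its head is not yet a vertex of $\mathcal G^{\ell-1}$, and otherwise let $\mathcal T^\ell=\mathcal T^{\ell-1}$. If there is no such edge, stop; $\mathcal T_x(s)$ is the final tree. Nice paths. Fix a constant $C>0$. A path $\mathbf p=(x_0,\dots,x_t)$ of length $t$ from $x=x_0$ to $y=x_t$ is nice if (i) $\mathbf m(\mathbf p)\le\frac1{n\log^3n}$; (ii) its first $s$ edges belong to $\mathcal T_x(s)$; (iii) its last $h$ steps $(x_{s+1},\dots,x_t)$ form the unique path in $G$ of length at most $h$ from $x_{s+1}$ to $y$; (iv) $P(x_s,x_{s+1})\ge\frac1{C\log n}$. Let $\tilde P^t(x,y)$ be the sum of $\mathbf m(\mathbf p)$ over all nice paths $\mathbf p$ from $x$ to $y$, that is, the probability that the random walk goes from $x$ to $y$ in $t$ steps along a nice path, and let $\tilde\pi=\mu_{\rm in}P^h$. Proposition 5.4. For every $\delta>0$ (and all choices of $\varepsilon\in(0,1)$ and $C>0$ above), $$\lim_{n\to\infty}\mathbb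 P\Big(\tilde P^t(x,y)\le(1+\delta)\,\tilde\pi(y)+\frac\delta n\quad\text{for all }x\in V_\varepsilon\text{ and all }y\in[n]\Big)=1.$$ -/

import Mathlib

open MeasureTheory Filter Topology

noncomputable section

namespace ChungLu

open scoped Classical in
/-- The out-degree `D_x^+` of a vertex. -/
def outDeg {n : ℕ} (G : Digraph (Fin n)) (x : Fin n) : ℕ :=
  (Finset.univ.filter fun y => G.Adj x y).card

open scoped Classical in
/-- Transition matrix of the simple random walk: `1 / D_x^+` on edges `x → y`, and `0` otherwise. -/
def walk {n : ℕ} (G : Digraph (Fin n)) : Matrix (Fin n) (Fin n) ℝ :=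
  fun x y => if G.Adj x y then 1 / (outDeg G x : ℝ) else 0

/-- The mass `m(p) = ∏ P(x_i, x_{i+1})` of a path, given as the list `[x_0, …, x_t]` of its
successive vertices. -/
def mass {n : ℕ} (G : Digraph (Fin n)) : List (Fin n) → ℝ
  | [] => 1
  | [_] => 1
  | a :: b :: l => walk G a b * mass G (b :: l)

/-- `p = [x_0, …, x_k]` is an oriented path of `G` of length `k` from `x = x_0` to `y = x_k`
(vertices may be repeated, as in a trajectory of the walk). -/
def IsPath {n : ℕ} (G : Digraph (Fin n)) (x y : Fin n) (k : ℕ) (p : List (Fin n)) : Prop :=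
  p.length = k + 1 ∧ p.head? = some x ∧ p.getLast? = some y ∧ p.IsChain G.Adj

/-! ### The random graph -/

/-- Connection probability `p_{xy} = min (w_x^+ w_y^- log n / n) 1` of two distinct vertices. -/
def edgeProb {n : ℕ} (wp wm : Fin n → ℝ) (x y : Fin n) : ℝ :=
  min (wp x * wm y * (Real.log n / n)) 1

/-- Law of the independent edge indicators: the coordinate `(x, y)` is `true` with probability
`edgeProb wp wm x y`, independently. The projection onto `[0, 1]` only serves the type, since
`edgeProb wp wm x y` lies in `[0, 1]` for positive weights. The diagonal coordinates are not used
by the graph. -/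
def law {n : ℕ} (wp wm : Fin n → ℝ) : Measure (Fin n × Fin n → Bool) :=
  Measure.pi fun e => ProbabilityTheory.bernoulliMeasure true false
    (Set.projIcc (0 : ℝ) 1 zero_le_one (edgeProb wp wm e.1 e.2))

/-- The loopless digraph with the given edge indicators. -/
def graph {n : ℕ} (ω : Fin n × Fin n → Bool) : Digraph (Fin n) where
  Adj x y := x ≠ y ∧ ω (x, y) = true

/-- The in-degree distribution `μ_in(x) = w_x^- / w`, where `w = ∑ w_z^-`. -/
def muIn {n : ℕ} (wm : Fin n → ℝ) (x : Fin n) : ℝ := wm x / ∑ z, wm z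

/-- The entropy `H = E × μ_in [log (D_V^+ ∨ 1)]`. -/
def entropy {n : ℕ} (wp wm : Fin n → ℝ) : ℝ :=
  ∑ x, muIn wm x * ∫ ω, Real.log (max (outDeg (graph ω) x : ℝ) 1) ∂(law wp wm)

/-- The entropic time `t_ent = log n / H`. -/
def tEnt {n : ℕ} (wp wm : Fin n → ℝ) : ℝ := Real.log n / entropy wp wm

/-- The integer part of `h_ε = ε log n / (20 H)`. -/
def hSteps {n : ℕ} (wp wm : Fin n → ℝ) (ε : ℝ) : ℕ :=
  ⌊ε * Real.log n / (20 * entropy wp wm)⌋₊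

/-- The integer part of `s = (1 - γ) t_ent`. -/
def sSteps {n : ℕ} (wp wm : Fin n → ℝ) (γ : ℝ) : ℕ :=
  ⌊(1 - γ) * tEnt wp wm⌋₊

/-! ### Roots -/

/-- Vertex set of the out-neighbourhood of `x` of radius `h`. -/
def outBall {n : ℕ} (G : Digraph (Fin n)) (x : Fin n) (h : ℕ) : Set (Fin n) :=
  {y | ∃ k ≤ h, ∃ p, IsPath G x y k p}

/-- Edges of the out-neighbourhood of `x` of radius `h`: those lying on an oriented path of length
at most `h` that starts at `x`. -/
def outBallEdges {n : ℕ} (G : Digraph (Fin n)) (x : Fin n) (h : ℕ) : Set (Fin n × Fin n) :=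
  {e | G.Adj e.1 e.2 ∧ ∃ k < h, ∃ p, IsPath G x e.1 k p}

/-- `x` is an `h`-root: its out-neighbourhood of radius `h` is a directed tree. All its vertices
are reached from `x`, so this says that the tree excess `1 + |E| - |V|` vanishes. -/
def IsRoot {n : ℕ} (G : Digraph (Fin n)) (h : ℕ) (x : Fin n) : Prop :=
  1 + (outBallEdges G x h).ncard = (outBall G x h).ncard

/-! ### The tree `T_x(s)` -/

/-- State of the exploration process. -/
structure State (n : ℕ) where
  /-- the edges visited so far, i.e. the edges of the explored subgraph -/
  visited : Finset (Fin n × Fin n)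
  /-- the vertices of the explored subgraph, which are those of its spanning tree -/
  verts : Finset (Fin n)
  /-- the edges of the spanning tree -/
  tree : Finset (Fin n × Fin n)
  /-- the path from the root in the spanning tree, for every vertex in `verts` -/
  path : Fin n → List (Fin n)

/-- Initial state: the single vertex `x`. -/
def initState {n : ℕ} (x : Fin n) : State n where
  visited := ∅
  verts := {x}
  tree := ∅
  path := fun _ => [x]

/-- Cumulative mass of an edge: mass of the tree path from the root to its tail `e.1`, times
`1 / D^+` of the tail. -/
def cumMass {n : ℕ} (G : Digraph (Fin n)) (σ : State n) (e : Fin n × Fin n) : ℝ :=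
  mass G (σ.path e.1) * (1 / (outDeg G e.1 : ℝ))

open scoped Classical in
/-- The unvisited edges whose tail is an explored vertex at tree distance at most `s - 1` from the
root (the list `σ.path v` has one more entry than that distance). -/
def openEdges {n : ℕ} (G : Digraph (Fin n)) (s : ℕ) (σ : State n) : Finset (Fin n × Fin n) :=
  Finset.univ.filter fun e =>
    G.Adj e.1 e.2 ∧ e.1 ∈ σ.verts ∧ e ∉ σ.visited ∧ (σ.path e.1).length ≤ s

open scoped Classical in
/-- The edges the next iteration may choose: those of maximal cumulative mass, provided that this
maximum is at least `θ`. -/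
def candidates {n : ℕ} (G : Digraph (Fin n)) (s : ℕ) (θ : ℝ) (σ : State n) :
    Finset (Fin n × Fin n) :=
  (openEdges G s σ).filter fun e =>
    (∀ e' ∈ openEdges G s σ, cumMass G σ e' ≤ cumMass G σ e) ∧ θ ≤ cumMass G σ e

/-- Visit the edge `e`; it is added to the tree if its head has not been explored before. -/
def visit {n : ℕ} (σ : State n) (e : Fin n × Fin n) : State n where
  visited := insert e σ.visited
  verts := insert e.2 σ.verts
  tree := if e.2 ∈ σ.verts then σ.tree else insert e σ.tree
  path := if e.2 ∈ σ.verts then σ.path else Function.update σ.path e.2 (σ.path e.1 ++ [e.2])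

open scoped Classical in
/-- One iteration. Among the candidates an edge is chosen by the rule `tie`; if there is no
candidate, the state no longer changes. -/
def step {n : ℕ} (G : Digraph (Fin n)) (s : ℕ) (θ : ℝ)
    (tie : Finset (Fin n × Fin n) → Fin n × Fin n) (σ : State n) : State n :=
  if (candidates G s θ σ).Nonempty then visit σ (tie (candidates G s θ σ)) else σ

/-- Edges of the tree `T_x(s)`, with mass threshold `θ`. Every effective iteration visits a new
edge, so the procedure has stopped after `n * n` iterations. -/
def treeEdges {n : ℕ} (G : Digraph (Fin n)) (s : ℕ) (θ : ℝ)
    (tie : Finset (Fin n × Fin n) → Fin n × Fin n) (x : Fin n) : Finset (Fin n × Fin n) :=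
  ((step G s θ tie)^[n * n] (initState x)).tree

/-! ### Nice paths -/

/-- The list `p = [x_0, …, x_t]` is a nice path of length `t = s + h + 1` from `x` to `y`. Here
`θ` is the mass threshold of the tree `T_x(s)` and `C` the constant in the degree condition. The
list `p.take (s + 1)` consists of the first `s` steps, and `p.drop (s + 1)` of the last `h`. -/
def IsNice {n : ℕ} (G : Digraph (Fin n)) (s h : ℕ) (θ C : ℝ)
    (tie : Finset (Fin n × Fin n) → Fin n × Fin n) (x y : Fin n) (p : List (Fin n)) : Prop :=
  IsPath G x y (s + h + 1) p ∧
  mass G p ≤ 1 / (n * Real.log n ^ 3) ∧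
  (p.take (s + 1)).IsChain (fun a b => (a, b) ∈ treeEdges G s θ tie x) ∧
  (∀ v, p[s + 1]? = some v → ∀ k ≤ h, ∀ q, IsPath G v y k q → q = p.drop (s + 1)) ∧
  (∀ u v, p[s]? = some u → p[s + 1]? = some v → 1 / (C * Real.log n) ≤ walk G u v)

open scoped Classical in
/-- The probability that the walk goes from `x` to `y` in `t = s + h + 1` steps along a nice
path, i.e. the sum of the masses of the nice paths. -/
def niceProb {n : ℕ} (G : Digraph (Fin n)) (s h : ℕ) (θ C : ℝ)
    (tie : Finset (Fin n × Fin n) → Fin n × Fin n) (x y : Fin n) : ℝ :=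
  ∑ p : List.Vector (Fin n) (s + h + 2),
    if IsNice G s h θ C tie x y p.toList then mass G p.toList else 0

/-- The measure `π̃ = μ_in P^h`. -/
def piTilde {n : ℕ} (wm : Fin n → ℝ) (G : Digraph (Fin n)) (h : ℕ) (y : Fin n) : ℝ :=
  Matrix.vecMul (muIn wm) (walk G ^ h) y

/-- The event that `P̃^t(x, y) ≤ (1 + δ) π̃(y) + δ / n` for all `h_ε`-roots `x` and all vertices
`y`, where `γ = ε / 80`, and `T_x(s)` has mass threshold `exp (-(1 + γ) H s)`. -/
def goodEvent {n : ℕ} (wp wm : Fin n → ℝ) (ε C δ : ℝ)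
    (tie : Fin n → Finset (Fin n × Fin n) → Fin n × Fin n) : Set (Fin n × Fin n → Bool) :=
  {ω | ∀ x y, IsRoot (graph ω) (hSteps wp wm ε) x →
    niceProb (graph ω) (sSteps wp wm (ε / 80)) (hSteps wp wm ε)
        (Real.exp (-((1 + ε / 80) * entropy wp wm * sSteps wp wm (ε / 80)))) C (tie x) x y
      ≤ (1 + δ) * piTilde wm (graph ω) (hSteps wp wm ε) y + δ / n}

end ChungLu

end

/-!
The proof compares the nice paths from `x` to `y` with the edges `u → v` they use at time `s`,
where `u` lies at depth `s` in the tree `T_x(s)` and `v` at distance exactly `h` to `y`. Call `U`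
the set of the vertices of the first kind (`bottom`) and `S` the set of those of the second kind
(`sphere`). By uniqueness of the last `h` steps, a nice path is determined by this edge
(`IsNice.decomp`).

The point is that the edges from `U` to `S` are fresh. The tree never looks at the out-edges of
vertices at depth `s` (`finalState_congr`), and the sphere of radius `h` around `y` is found by
looking only at edges into vertices closer to `y` (`sphere_congr`). So `U`, `S`, the masses of the
tree paths, and the whole graph `G'` without the edges into `S` (`cut`) are functions of the
indicators outside `U × S`. Those in `U × S` may be resampled with their original law
(`expect_eq_expect_merge`), and a Chernoff bound applies to any linear statistic of them whose
coefficients are functions of the rest (`prob_linear_unrevealed_ge_le`).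

The mass of a nice path involves the out-degrees in `G`, which do depend on the fresh edges. They
are replaced by the out-degrees in `G'`. This only increases the mass, and by a factor `1 + o(1)`
over all `h + 1 = o(log n)` steps: every out-degree is at least `c log n` because `M₀ > 1`, and
every vertex sends a bounded number of edges into `S`, because the total in-weight of `S` is at
most `n ^ (4 / 5)` (`prob_sphere_growth`, `prob_card_adj_sphere_ge`). With these weights, each at
most `2 / (n log³ n)`, the sum over the fresh edges concentrates (`prob_crossing_ge`) and its
conditional mean is at most `∑ m(u) (E D_u / D_u') · μ_in P'^h (y)`. Here `μ_in P'^h ≤ (1 + o(1))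
μ_in P^h`. The first factor is `1 + o(1)` since the rows of the vertices of `U` are fresh with
respect to the tree, `E [1 / D] ≤ (1 + o(1)) / E D`, and each `m(u)` is small
(`prob_sum_inv_deg_ge`).

Of the entropy only its order `log log n` is needed. It gives `h = o(log n)`, growth factors
`(log n) ^ O(h)` of the spheres that are small powers of `n`, and `s ≥ 4`.

Probabilities are handled as finite sums over configurations (`expect`, `prob`).
-/

noncomputable section

namespace ChungLu

/-! ### Independent Bernoulli variables as finite sums -/

section Bernoulli

variable {ι α β : Type*}

/-- The configuration that equals `ω'` on `A` and `ω` off `A`. -/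
def merge [DecidableEq ι] (A : Finset ι) (ω ω' : ι → Bool) : ι → Bool :=
  fun i => if i ∈ A then ω' i else ω i

lemma merge_of_mem [DecidableEq ι] {A : Finset ι} {ω ω' : ι → Bool} {i : ι} (h : i ∈ A) :
    merge A ω ω' i = ω' i := by simp [merge, h]

lemma merge_of_notMem [DecidableEq ι] {A : Finset ι} {ω ω' : ι → Bool} {i : ι} (h : i ∉ A) :
    merge A ω ω' i = ω i := by simp [merge, h]

variable [Fintype ι] [Fintype α] [Fintype β]

/-- Weight of the configuration `ω` under independent Bernoulli variables of parameters `p i`. -/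
def bernWeight (p : ι → ℝ) (ω : ι → Bool) : ℝ := ∏ i, if ω i then p i else 1 - p i

lemma bernWeight_nonneg {p : ι → ℝ} (hp : ∀ i, 0 ≤ p i ∧ p i ≤ 1) (ω : ι → Bool) :
    0 ≤ bernWeight p ω := by
  refine Finset.prod_nonneg fun i _ => ?_
  split_ifs
  · exact (hp i).1
  · linarith [(hp i).2]

/-- Expectation under independent Bernoulli variables of parameters `p i`, as a finite sum. -/
def expect [DecidableEq ι] (p : ι → ℝ) (f : (ι → Bool) → ℝ) : ℝ := ∑ ω, bernWeight p ω * f ω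

/-- Probability under independent Bernoulli variables of parameters `p i`. -/
def prob [DecidableEq ι] (p : ι → ℝ) (S : Set (ι → Bool)) : ℝ := expect p (S.indicator 1)

variable [DecidableEq ι] [DecidableEq α] [DecidableEq β] {p : ι → ℝ}

lemma expect_prod (p : ι → ℝ) (f : ι → Bool → ℝ) :
    expect p (fun ω => ∏ i, f i (ω i)) = ∏ i, (p i * f i true + (1 - p i) * f i false) := by
  have h : ∀ i, p i * f i true + (1 - p i) * f i false
      = ∑ b ∈ (Finset.univ : Finset Bool), (if b then p i else 1 - p i) * f i b := by
    intro i; simp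
  simp only [h, Finset.prod_univ_sum, Fintype.piFinset_univ, expect, bernWeight,
    Finset.prod_mul_distrib]

lemma expect_const (p : ι → ℝ) (c : ℝ) : expect p (fun _ => c) = c := by
  have := expect_prod p (fun _ _ => 1)
  simp [expect] at this ⊢
  rw [← Finset.sum_mul, this, one_mul]

lemma expect_mono (hp : ∀ i, 0 ≤ p i ∧ p i ≤ 1) {f g : (ι → Bool) → ℝ} (h : ∀ ω, f ω ≤ g ω) :
    expect p f ≤ expect p g :=
  Finset.sum_le_sum fun ω _ => mul_le_mul_of_nonneg_left (h ω) (bernWeight_nonneg hp ω)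

lemma expect_nonneg (hp : ∀ i, 0 ≤ p i ∧ p i ≤ 1) {f : (ι → Bool) → ℝ} (h : ∀ ω, 0 ≤ f ω) :
    0 ≤ expect p f :=
  Finset.sum_nonneg fun ω _ => mul_nonneg (bernWeight_nonneg hp ω) (h ω)

lemma expect_add (p : ι → ℝ) (f g : (ι → Bool) → ℝ) :
    expect p (fun ω => f ω + g ω) = expect p f + expect p g := by
  simp [expect, mul_add, Finset.sum_add_distrib]

lemma expect_mul_left (p : ι → ℝ) (c : ℝ) (f : (ι → Bool) → ℝ) :
    expect p (fun ω => c * f ω) = c * expect p f := by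
  simp [expect, Finset.mul_sum, mul_left_comm]

lemma expect_sum {κ : Type*} (p : ι → ℝ) (s : Finset κ) (f : κ → (ι → Bool) → ℝ) :
    expect p (fun ω => ∑ k ∈ s, f k ω) = ∑ k ∈ s, expect p (f k) := by
  simp only [expect, Finset.mul_sum]
  exact Finset.sum_comm

lemma expect_coord (p : ι → ℝ) (i : ι) : expect p (fun ω => if ω i then 1 else 0) = p i := by
  have := expect_prod p (fun j b => if j = i then (if b then 1 else 0) else 1)
  simp only [Finset.prod_ite_eq', Finset.mem_univ, if_true] at this
  rw [this, Finset.prod_eq_single i]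
  · simp
  · intro j _ hj; simp [hj]
  · simp

lemma prob_mono (hp : ∀ i, 0 ≤ p i ∧ p i ≤ 1) {S T : Set (ι → Bool)} (h : S ⊆ T) :
    prob p S ≤ prob p T :=
  expect_mono hp fun ω => Set.indicator_le_indicator_of_subset h (fun _ => zero_le_one) ω

lemma prob_iUnion_le {κ : Type*} [Fintype κ] (hp : ∀ i, 0 ≤ p i ∧ p i ≤ 1)
    (S : κ → Set (ι → Bool)) : prob p (⋃ k, S k) ≤ ∑ k, prob p (S k) := by
  classical
  simp only [prob]
  rw [← expect_sum p Finset.univ (fun k => (S k).indicator 1)]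
  refine expect_mono hp fun ω => ?_
  have h0 : ∀ k ∈ Finset.univ, (0 : ℝ) ≤ (S k).indicator 1 ω :=
    fun k _ => Set.indicator_nonneg (fun _ _ => zero_le_one) _
  by_cases h : ω ∈ ⋃ k, S k
  · obtain ⟨k, hk⟩ := Set.mem_iUnion.1 h
    calc (⋃ k, S k).indicator (1 : (ι → Bool) → ℝ) ω = (S k).indicator 1 ω := by simp [h, hk]
      _ ≤ _ := Finset.single_le_sum h0 (Finset.mem_univ k)
  · rw [Set.indicator_of_notMem h]
    exact Finset.sum_nonneg h0

/-- Union bound with a common bound for the terms. -/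
lemma prob_iUnion_le_card_mul {κ : Type*} [Fintype κ] (hp : ∀ i, 0 ≤ p i ∧ p i ≤ 1)
    (S : κ → Set (ι → Bool)) {b : ℝ} (h : ∀ k, prob p (S k) ≤ b) :
    prob p (⋃ k, S k) ≤ Fintype.card κ * b := by
  refine (prob_iUnion_le hp S).trans ((Finset.sum_le_sum fun k _ => h k).trans ?_)
  simp

lemma prob_union_le (hp : ∀ i, 0 ≤ p i ∧ p i ≤ 1) (S T : Set (ι → Bool)) :
    prob p (S ∪ T) ≤ prob p S + prob p T := by
  have := prob_iUnion_le hp (fun b : Bool => if b then S else T)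
  have h : (⋃ b : Bool, if b then S else T) = S ∪ T := by
    ext ω; simp [or_comm]
  rw [h] at this
  simpa using this

/-- Exponential Markov inequality. -/
lemma prob_le_of_expect_exp (hp : ∀ i, 0 ≤ p i ∧ p i ≤ 1) (X : (ι → Bool) → ℝ) (t : ℝ) :
    prob p {ω | t ≤ X ω} ≤ Real.exp (-t) * expect p (fun ω => Real.exp (X ω)) := by
  rw [← expect_mul_left]
  refine expect_mono hp fun ω => ?_
  by_cases h : ω ∈ {ω | t ≤ X ω}
  · rw [Set.indicator_of_mem h, ← Real.exp_add]
    have : t ≤ X ω := h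
    exact Real.one_le_exp (by linarith)
  · rw [Set.indicator_of_notMem h]
    positivity

lemma expect_exp_linear_le (hp : ∀ i, 0 ≤ p i ∧ p i ≤ 1) (s : Finset ι) (c : ι → ℝ) :
    expect p (fun ω => Real.exp (∑ i ∈ s, if ω i then c i else 0))
      ≤ Real.exp (∑ i ∈ s, p i * (Real.exp (c i) - 1)) := by
  have h1 : ∀ ω : ι → Bool, Real.exp (∑ i ∈ s, if ω i then c i else 0)
      = ∏ i, (fun i b => if i ∈ s then Real.exp (if b then c i else 0) else 1) i (ω i) := by
    intro ω
    rw [Real.exp_sum]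
    simp [Finset.prod_ite_mem]
  rw [funext h1, expect_prod p (fun i b => if i ∈ s then Real.exp (if b then c i else 0) else 1),
    Real.exp_sum, ← Finset.prod_subset (Finset.subset_univ s)]
  · refine Finset.prod_le_prod (fun i hi => ?_) (fun i hi => ?_)
    · have := hp i
      simp only [hi, if_true]
      have : 0 ≤ (1 - p i) := by linarith [this.2]
      have h3 := (hp i).1
      positivity
    · simp only [hi, if_true, Bool.false_eq_true, if_false, Real.exp_zero, mul_one]
      have := Real.add_one_le_exp (p i * (Real.exp (c i) - 1))
      linarith
  · intro i _ hi
    simp [hi]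

/-- Chernoff bound for a linear statistic of independent Bernoulli variables. The free parameter
of the exponential moment is part of the coefficients. -/
lemma prob_linear_ge_le (hp : ∀ i, 0 ≤ p i ∧ p i ≤ 1) (s : Finset ι) (c : ι → ℝ) (t ℓ : ℝ)
    (h : ∑ i ∈ s, p i * (Real.exp (c i) - 1) ≤ t - ℓ) :
    prob p {ω | t ≤ ∑ i ∈ s, if ω i then c i else 0} ≤ Real.exp (-ℓ) := by
  refine (prob_le_of_expect_exp hp _ t).trans ?_
  calc Real.exp (-t) * expect p (fun ω => Real.exp (∑ i ∈ s, if ω i then c i else 0))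
      ≤ Real.exp (-t) * Real.exp (t - ℓ) := by
        gcongr
        exact (expect_exp_linear_le hp s c).trans (Real.exp_le_exp.2 h)
    _ = Real.exp (-ℓ) := by rw [← Real.exp_add]; congr 1; ring

/-! ### Resampling the unrevealed coordinates -/

lemma bernWeight_merge_mul (p : ι → ℝ) (A : Finset ι) (ω ω' : ι → Bool) :
    bernWeight p (merge A ω ω') * bernWeight p (merge A ω' ω)
      = bernWeight p ω * bernWeight p ω' := by
  simp only [bernWeight, ← Finset.prod_mul_distrib]
  refine Finset.prod_congr rfl fun i _ => ?_
  by_cases h : i ∈ A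
  · simp only [merge_of_mem h]; ring
  · simp only [merge_of_notMem h]

/-- `A ω` is a set of coordinates that is determined by the coordinates outside it. Revealing the
latter leaves the coordinates in `A ω` independent with their original law: they may be resampled.
The reason is that exchanging the coordinates in `A ω` between two independent copies is an
involution which preserves the product weight. -/
lemma expect_eq_expect_merge (p : ι → ℝ) (A : (ι → Bool) → Finset ι)
    (hA : ∀ ω ω', (∀ i ∉ A ω, ω' i = ω i) → A ω' = A ω) (g : (ι → Bool) → ℝ) :
    expect p g = expect p (fun ω => expect p (fun ω' => g (merge (A ω) ω ω'))) := by
  have hA' : ∀ ω ω', A (merge (A ω) ω ω') = A ω := fun ω ω' =>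
    hA _ _ fun i hi => merge_of_notMem hi
  let Φ : (ι → Bool) × (ι → Bool) → (ι → Bool) × (ι → Bool) :=
    fun z => (merge (A z.1) z.1 z.2, merge (A z.1) z.2 z.1)
  have hΦ : Function.Involutive Φ := by
    rintro ⟨ω, ω'⟩
    simp only [Φ, hA']
    ext i <;> by_cases h : i ∈ A ω <;> simp [merge, h]
  have h1 : expect p g = ∑ z : (ι → Bool) × (ι → Bool),
      bernWeight p z.1 * bernWeight p z.2 * g z.1 := by
    rw [Fintype.sum_prod_type]
    refine Finset.sum_congr rfl fun ω _ => ?_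
    have h2 : bernWeight p ω * g ω
        = bernWeight p ω * expect p (fun _ => g ω) := by rw [expect_const]
    rw [h2, expect, Finset.mul_sum]
    exact Finset.sum_congr rfl fun ω' _ => by ring
  rw [h1, ← Equiv.sum_comp hΦ.toPerm, Fintype.sum_prod_type]
  refine Finset.sum_congr rfl fun ω _ => ?_
  simp only [expect]
  rw [Finset.mul_sum]
  refine Finset.sum_congr rfl fun ω' _ => ?_
  simp only [Function.Involutive.coe_toPerm, Φ]
  rw [bernWeight_merge_mul]; ring

lemma prob_le_of_merge (hp : ∀ i, 0 ≤ p i ∧ p i ≤ 1) (A : (ι → Bool) → Finset ι)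
    (hA : ∀ ω ω', (∀ i ∉ A ω, ω' i = ω i) → A ω' = A ω) (S : Set (ι → Bool)) (ρ : ℝ)
    (h : ∀ ω, prob p {ω' | merge (A ω) ω ω' ∈ S} ≤ ρ) : prob p S ≤ ρ := by
  rw [prob, expect_eq_expect_merge p A hA]
  refine (expect_mono hp h).trans ?_
  rw [expect_const]

/-- Chernoff bound for a linear statistic of the unrevealed coordinates `A ω`, whose coefficients
and threshold are determined by the revealed ones. -/
lemma prob_linear_unrevealed_ge_le (hp : ∀ i, 0 ≤ p i ∧ p i ≤ 1) (A : (ι → Bool) → Finset ι)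
    (hA : ∀ ω ω', (∀ i ∉ A ω, ω' i = ω i) → A ω' = A ω)
    (c : (ι → Bool) → ι → ℝ) (hc : ∀ ω ω', (∀ i ∉ A ω, ω' i = ω i) → ∀ i ∈ A ω, c ω' i = c ω i)
    (t : (ι → Bool) → ℝ) (ht : ∀ ω ω', (∀ i ∉ A ω, ω' i = ω i) → t ω' = t ω) (ℓ : ℝ)
    (h : ∀ ω, ∑ i ∈ A ω, p i * (Real.exp (c ω i) - 1) ≤ t ω - ℓ) :
    prob p {ω | t ω ≤ ∑ i ∈ A ω, if ω i then c ω i else 0} ≤ Real.exp (-ℓ) := by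
  refine prob_le_of_merge hp A hA _ _ fun ω => ?_
  refine le_trans (prob_mono hp ?_) (prob_linear_ge_le hp (A ω) (c ω) (t ω) ℓ (h ω))
  intro ω' hω'
  have hag : ∀ i ∉ A ω, merge (A ω) ω ω' i = ω i := fun i hi => merge_of_notMem hi
  simp only [Set.mem_ofPred_eq, hA _ _ hag, ht _ _ hag] at hω' ⊢
  refine hω'.trans (le_of_eq (Finset.sum_congr rfl fun i hi => ?_))
  rw [merge_of_mem hi, hc _ _ hag i hi]

/-! ### Independent rows -/

lemma expect_prod_rows (p : α × β → ℝ) (F : α → (β → Bool) → ℝ) :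
    expect p (fun ω => ∏ a, F a (fun b => ω (a, b)))
      = ∏ a, expect (fun b => p (a, b)) (F a) := by
  simp only [expect]
  rw [Finset.prod_univ_sum, Fintype.piFinset_univ,
    ← Equiv.sum_comp (Equiv.curry α β Bool).symm]
  refine Finset.sum_congr rfl fun r _ => ?_
  rw [Finset.prod_mul_distrib]
  congr 1
  rw [bernWeight, Fintype.prod_prod_type]
  rfl

lemma expect_row (p : α × β → ℝ) (a : α) (f : (β → Bool) → ℝ) :
    expect p (fun ω => f (fun b => ω (a, b))) = expect (fun b => p (a, b)) f := by
  have := expect_prod_rows p (fun a' r => if a' = a then f r else 1)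
  simp only [Finset.prod_ite_eq', Finset.mem_univ, if_true] at this
  rw [this, Finset.prod_eq_single a]
  · simp
  · intro j _ hj; simp [hj, expect_const]
  · simp

lemma prob_row (p : α × β → ℝ) (a : α) (S : Set (β → Bool)) :
    prob p {ω | (fun b => ω (a, b)) ∈ S} = prob (fun b => p (a, b)) S :=
  expect_row p a (S.indicator 1)

/-- Chernoff bound for a sum of functions of the unrevealed rows `U ω`, the weights `m ω` of the
rows being determined by the revealed ones. -/
lemma prob_rows_unrevealed_ge_le {p : α × β → ℝ} (hp : ∀ i, 0 ≤ p i ∧ p i ≤ 1)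
    (U : (α × β → Bool) → Finset α)
    (hU : ∀ ω ω', (∀ a b, a ∉ U ω → ω' (a, b) = ω (a, b)) → U ω' = U ω)
    (m : (α × β → Bool) → α → ℝ)
    (hm : ∀ ω ω', (∀ a b, a ∉ U ω → ω' (a, b) = ω (a, b)) → ∀ a ∈ U ω, m ω' a = m ω a)
    (f : α → (β → Bool) → ℝ) (t ℓ : ℝ)
    (h : ∀ ω, ∏ a ∈ U ω, expect (fun b => p (a, b)) (fun r => Real.exp (m ω a * f a r))
      ≤ Real.exp (t - ℓ)) :
    prob p {ω | t ≤ ∑ a ∈ U ω, m ω a * f a (fun b => ω (a, b))} ≤ Real.exp (-ℓ) := by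
  have hag : ∀ ω ω' : α × β → Bool, (∀ i ∉ U ω ×ˢ (Finset.univ : Finset β), ω' i = ω i) →
      ∀ a b, a ∉ U ω → ω' (a, b) = ω (a, b) := by
    intro ω ω' h a b ha
    exact h (a, b) (by simp [ha])
  refine prob_le_of_merge hp (fun ω => U ω ×ˢ (Finset.univ : Finset β))
    (fun ω ω' h => by simp only [hU ω ω' (hag ω ω' h)]) _ _ fun ω => ?_
  have hsub : {ω' | merge (U ω ×ˢ (Finset.univ : Finset β)) ω ω' ∈
      {ω | t ≤ ∑ a ∈ U ω, m ω a * f a (fun b => ω (a, b))}}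
      ⊆ {ω' | t ≤ ∑ a ∈ U ω, m ω a * f a (fun b => ω' (a, b))} := by
    intro ω' hω'
    have hag' := hag ω (merge (U ω ×ˢ (Finset.univ : Finset β)) ω ω')
      fun i hi => merge_of_notMem hi
    simp only [Set.mem_ofPred_eq, hU _ _ hag'] at hω' ⊢
    refine hω'.trans (le_of_eq (Finset.sum_congr rfl fun a ha => ?_))
    rw [hm _ _ hag' a ha]
    congr 2
    ext b
    rw [merge_of_mem (by simp [ha])]
  refine (prob_mono hp hsub).trans ((prob_le_of_expect_exp hp _ t).trans ?_)
  have h2 : ∀ ω' : α × β → Bool,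
      Real.exp (∑ a ∈ U ω, m ω a * f a (fun b => ω' (a, b)))
      = ∏ a, (fun a r => if a ∈ U ω then Real.exp (m ω a * f a r) else 1) a
          (fun b => ω' (a, b)) := by
    intro ω'
    rw [Real.exp_sum]
    simp [Finset.prod_ite_mem]
  simp only [h2]
  rw [expect_prod_rows p (fun a r => if a ∈ U ω then Real.exp (m ω a * f a r) else 1),
    ← Finset.prod_subset (Finset.subset_univ (U ω))]
  · calc _ ≤ Real.exp (-t) * Real.exp (t - ℓ) := by
          gcongr
          refine le_trans (le_of_eq (Finset.prod_congr rfl fun a ha => ?_)) (h ω)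
          simp [ha]
      _ = Real.exp (-ℓ) := by rw [← Real.exp_add]; congr 1; ring
  · intro a _ ha
    simp [ha, expect_const]

end Bernoulli

/-! ### The law of the graph -/

lemma edgeProb_mem {n : ℕ} {wp wm : Fin n → ℝ} (hp : ∀ x, 0 ≤ wp x) (hm : ∀ x, 0 ≤ wm x)
    (x y : Fin n) : 0 ≤ edgeProb wp wm x y ∧ edgeProb wp wm x y ≤ 1 := by
  refine ⟨le_min ?_ zero_le_one, min_le_right _ _⟩
  have := hp x
  have := hm y
  have : 0 ≤ Real.log n := Real.log_natCast_nonneg n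
  positivity

instance {n : ℕ} (wp wm : Fin n → ℝ) : IsProbabilityMeasure (law wp wm) := by
  unfold law; infer_instance

lemma law_real_singleton {n : ℕ} {wp wm : Fin n → ℝ} (hp : ∀ x, 0 ≤ wp x) (hm : ∀ x, 0 ≤ wm x)
    (ω : Fin n × Fin n → Bool) :
    (law wp wm).real {ω} = bernWeight (fun e => edgeProb wp wm e.1 e.2) ω := by
  rw [law, Measure.real, Measure.pi_singleton, ENNReal.toReal_prod]
  refine Finset.prod_congr rfl fun e _ => ?_
  have he : (Set.projIcc (0 : ℝ) 1 zero_le_one (edgeProb wp wm e.1 e.2) : ℝ)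
      = edgeProb wp wm e.1 e.2 := by
    rw [Set.projIcc_of_mem zero_le_one (edgeProb_mem hp hm e.1 e.2)]
  rw [← Measure.real]
  cases h : ω e
  · rw [ProbabilityTheory.bernoulliMeasure_real_apply_of_notMem_of_mem _
      (MeasurableSet.singleton _) (by simp) (by simp), he]
    simp
  · rw [ProbabilityTheory.bernoulliMeasure_real_apply_of_mem_of_notMem _
      (MeasurableSet.singleton _) (by simp) (by simp), he]
    simp

lemma integral_law {n : ℕ} {wp wm : Fin n → ℝ} (hp : ∀ x, 0 ≤ wp x) (hm : ∀ x, 0 ≤ wm x)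
    (f : (Fin n × Fin n → Bool) → ℝ) :
    ∫ ω, f ω ∂(law wp wm) = expect (fun e => edgeProb wp wm e.1 e.2) f := by
  rw [integral_fintype .of_finite]
  simp only [law_real_singleton hp hm, expect, smul_eq_mul]

lemma law_real {n : ℕ} {wp wm : Fin n → ℝ} (hp : ∀ x, 0 ≤ wp x) (hm : ∀ x, 0 ≤ wm x)
    (S : Set (Fin n × Fin n → Bool)) :
    (law wp wm).real S = prob (fun e => edgeProb wp wm e.1 e.2) S := by
  rw [prob, ← integral_law hp hm, integral_indicator_one S.toFinite.measurableSet]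

/-! ### The exploration tree and the rows it depends on -/

section Tree

variable {n : ℕ}

/-- `G` and `G'` have the same edges out of `a`. -/
def SameRow (G G' : Digraph (Fin n)) (a : Fin n) : Prop := ∀ b, G.Adj a b ↔ G'.Adj a b

lemma SameRow.outDeg_eq {G G' : Digraph (Fin n)} {a : Fin n} (h : SameRow G G' a) :
    outDeg G a = outDeg G' a := by
  unfold outDeg
  congr 1
  ext b
  simp [h b]

lemma SameRow.walk_eq {G G' : Digraph (Fin n)} {a : Fin n} (h : SameRow G G' a) (b : Fin n) :
    walk G a b = walk G' a b := by
  have hb := h b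
  by_cases hG : G.Adj a b
  · simp [walk, hG, hb.1 hG, h.outDeg_eq]
  · simp [walk, hG, mt hb.2 hG]

lemma mass_concat_congr {G G' : Digraph (Fin n)} (l : List (Fin n)) (v : Fin n)
    (h : ∀ a ∈ l, SameRow G G' a) : mass G (l ++ [v]) = mass G' (l ++ [v]) := by
  induction l with
  | nil => simp [mass]
  | cons a l ih =>
    have ih' := ih fun b hb => h b (List.mem_cons_of_mem _ hb)
    cases l with
    | nil => simp [mass, (h a (by simp)).walk_eq]
    | cons b l =>
      simp only [List.cons_append, mass] at ih' ⊢
      rw [ih', (h a (by simp)).walk_eq]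

/-- Invariants of the exploration from `x`: tree paths start at `x`, follow edges of `G`, and
extend along tree edges. -/
structure TreeInv (G : Digraph (Fin n)) (x : Fin n) (σ : State n) : Prop where
  root_mem : x ∈ σ.verts
  root_path : σ.path x = [x]
  path_eq : ∀ v ∈ σ.verts, ∃ l, σ.path v = l ++ [v] ∧
    ∀ a ∈ l, a ∈ σ.verts ∧ (σ.path a).length < (σ.path v).length
  head_path : ∀ v ∈ σ.verts, (σ.path v).head? = some x
  chain_path : ∀ v ∈ σ.verts, (σ.path v).IsChain G.Adj
  tree_edge : ∀ a b, (a, b) ∈ σ.tree →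
    a ∈ σ.verts ∧ b ∈ σ.verts ∧ σ.path b = σ.path a ++ [b]

lemma treeInv_init (G : Digraph (Fin n)) (x : Fin n) : TreeInv G x (initState x) where
  root_mem := by simp [initState]
  root_path := rfl
  path_eq := by
    intro v hv
    simp only [initState, Finset.mem_singleton] at hv
    exact ⟨[], by simp [initState, hv], by simp⟩
  head_path := by simp [initState]
  chain_path := by simp [initState]
  tree_edge := by simp [initState]

/-- A step either changes nothing or visits an edge out of an explored vertex of depth `< s`. -/
lemma step_eq (G : Digraph (Fin n)) (s : ℕ) (θ : ℝ)
    {tie : Finset (Fin n × Fin n) → Fin n × Fin n} (htie : ∀ S, S.Nonempty → tie S ∈ S)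
    (σ : State n) : step G s θ tie σ = σ ∨
      ∃ e ∈ openEdges G s σ, step G s θ tie σ = visit σ e := by
  unfold step
  split_ifs with h
  · right
    exact ⟨_, (Finset.mem_filter.1 (htie _ h)).1, rfl⟩
  · exact Or.inl rfl

lemma TreeInv.visit {G : Digraph (Fin n)} {x : Fin n} {σ : State n} (h : TreeInv G x σ)
    {e : Fin n × Fin n} (he : G.Adj e.1 e.2) (he1 : e.1 ∈ σ.verts) : TreeInv G x (visit σ e) := by
  by_cases hm : e.2 ∈ σ.verts
  · have hv : ChungLu.visit σ e = { σ with visited := insert e σ.visited } := by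
      simp [ChungLu.visit, hm]
    rw [hv]
    exact ⟨h.root_mem, h.root_path, h.path_eq, h.head_path, h.chain_path, h.tree_edge⟩
  have hne : ∀ v ∈ σ.verts, v ≠ e.2 := fun v hv hve => hm (hve ▸ hv)
  have hpath : ∀ v ∈ σ.verts, (ChungLu.visit σ e).path v = σ.path v := by
    intro v hv
    simp [ChungLu.visit, hm, hne v hv]
  have hnew : (ChungLu.visit σ e).path e.2 = σ.path e.1 ++ [e.2] := by
    simp [ChungLu.visit, hm]
  have hverts : (ChungLu.visit σ e).verts = insert e.2 σ.verts := rfl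
  have hsub : ∀ v ∈ σ.verts, v ∈ (ChungLu.visit σ e).verts := fun v hv =>
    Finset.mem_insert_of_mem hv
  obtain ⟨l, hl, hl'⟩ := h.path_eq _ he1
  refine ⟨hsub _ h.root_mem, by rw [hpath _ h.root_mem, h.root_path], ?_, ?_, ?_, ?_⟩
  · intro v hv
    rw [hverts, Finset.mem_insert] at hv
    rcases hv with rfl | hv
    · refine ⟨σ.path e.1, hnew, fun a ha => ?_⟩
      rw [hl, List.mem_append, List.mem_singleton] at ha
      rw [hnew, List.length_append]
      rcases ha with ha | rfl
      · have := hl' a ha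
        refine ⟨hsub _ this.1, ?_⟩
        rw [hpath _ this.1]
        simp; omega
      · refine ⟨hsub _ he1, ?_⟩
        rw [hpath _ he1]
        simp
    · obtain ⟨l, hl, hl'⟩ := h.path_eq v hv
      refine ⟨l, by rw [hpath v hv, hl], fun a ha => ?_⟩
      have := hl' a ha
      refine ⟨hsub _ this.1, ?_⟩
      rw [hpath _ this.1, hpath v hv]
      exact this.2
  · intro v hv
    rw [hverts, Finset.mem_insert] at hv
    rcases hv with rfl | hv
    · rw [hnew, List.head?_append, h.head_path _ he1]
      rfl
    · rw [hpath v hv, h.head_path v hv]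
  · intro v hv
    rw [hverts, Finset.mem_insert] at hv
    rcases hv with rfl | hv
    · rw [hnew]
      have hc := h.chain_path _ he1
      rw [List.isChain_append]
      refine ⟨hc, by simp, fun a ha b hb => ?_⟩
      rw [hl] at ha
      simp at ha hb
      subst ha hb
      exact he
    · rw [hpath v hv]
      exact h.chain_path v hv
  · intro a b hab
    have : (a, b) = e ∨ (a, b) ∈ σ.tree := by
      simpa [ChungLu.visit, hm] using hab
    rcases this with rfl | hab
    · exact ⟨hsub _ he1, Finset.mem_insert_self _ _, by rw [hnew, hpath _ he1]⟩
    · obtain ⟨h1, h2, h3⟩ := h.tree_edge a b hab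
      exact ⟨hsub _ h1, hsub _ h2, by rw [hpath _ h1, hpath _ h2, h3]⟩

lemma mem_openEdges {G : Digraph (Fin n)} {s : ℕ} {σ : State n} {e : Fin n × Fin n} :
    e ∈ openEdges G s σ ↔
      G.Adj e.1 e.2 ∧ e.1 ∈ σ.verts ∧ e ∉ σ.visited ∧ (σ.path e.1).length ≤ s := by
  simp [openEdges]

variable {G G' : Digraph (Fin n)} {s : ℕ} {θ : ℝ}
  {tie : Finset (Fin n × Fin n) → Fin n × Fin n} {x : Fin n} {σ : State n}

lemma TreeInv.step (htie : ∀ S, S.Nonempty → tie S ∈ S) (h : TreeInv G x σ) :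
    TreeInv G x (step G s θ tie σ) := by
  rcases step_eq G s θ htie σ with h' | ⟨e, he, h'⟩
  · rwa [h']
  · rw [h']
    rw [mem_openEdges] at he
    exact h.visit he.1 he.2.1

lemma treeInv_iterate (htie : ∀ S, S.Nonempty → tie S ∈ S) (k : ℕ) :
    TreeInv G x ((ChungLu.step G s θ tie)^[k] (initState x)) := by
  induction k with
  | zero => exact treeInv_init G x
  | succ k ih =>
    rw [Function.iterate_succ_apply']
    exact ih.step htie

lemma path_step (htie : ∀ S, S.Nonempty → tie S ∈ S) {v : Fin n}
    (hv : v ∈ σ.verts) :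
    v ∈ (step G s θ tie σ).verts ∧ (step G s θ tie σ).path v = σ.path v := by
  rcases step_eq G s θ htie σ with h' | ⟨e, -, h'⟩
  · rw [h']; exact ⟨hv, rfl⟩
  · rw [h']
    refine ⟨Finset.mem_insert_of_mem hv, ?_⟩
    by_cases hm : e.2 ∈ σ.verts
    · simp [visit, hm]
    · have : v ≠ e.2 := fun hve => hm (hve ▸ hv)
      simp [visit, hm, this]

lemma path_iterate (htie : ∀ S, S.Nonempty → tie S ∈ S) {v : Fin n} (hv : v ∈ σ.verts) (k : ℕ) :
    v ∈ ((step G s θ tie)^[k] σ).verts ∧ ((step G s θ tie)^[k] σ).path v = σ.path v := by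
  induction k with
  | zero => exact ⟨hv, rfl⟩
  | succ k ih =>
    rw [Function.iterate_succ_apply']
    have := path_step (G := G) (s := s) (θ := θ) htie ih.1
    exact ⟨this.1, this.2.trans ih.2⟩

/-- A step only looks at the rows of the explored vertices of depth `< s`. -/
lemma step_congr (h : TreeInv G x σ)
    (hrow : ∀ v ∈ σ.verts, (σ.path v).length ≤ s → SameRow G G' v) :
    step G s θ tie σ = step G' s θ tie σ := by
  have hopen : openEdges G s σ = openEdges G' s σ := by
    ext e
    simp only [mem_openEdges]
    constructor
    · rintro ⟨h1, h2, h3, h4⟩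
      exact ⟨(hrow _ h2 h4 _).1 h1, h2, h3, h4⟩
    · rintro ⟨h1, h2, h3, h4⟩
      exact ⟨(hrow _ h2 h4 _).2 h1, h2, h3, h4⟩
  have hcum : ∀ e ∈ openEdges G' s σ, cumMass G σ e = cumMass G' σ e := by
    intro e he
    rw [mem_openEdges] at he
    obtain ⟨l, hl, hl'⟩ := h.path_eq _ he.2.1
    unfold cumMass
    rw [(hrow _ he.2.1 he.2.2.2).outDeg_eq, hl, mass_concat_congr l e.1]
    intro a ha
    obtain ⟨h1, h2⟩ := hl' a ha
    exact hrow a h1 (by omega)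
  have hcand : candidates G s θ σ = candidates G' s θ σ := by
    unfold candidates
    rw [hopen]
    refine Finset.filter_congr fun e he => ?_
    rw [hcum e he]
    refine and_congr_left' (forall₂_congr fun e' he' => ?_)
    rw [hcum e' he']
  unfold step
  rw [hcand]

/-- The final state of the exploration. -/
def finalState (G : Digraph (Fin n)) (s : ℕ) (θ : ℝ)
    (tie : Finset (Fin n × Fin n) → Fin n × Fin n) (x : Fin n) : State n :=
  (step G s θ tie)^[n * n] (initState x)

/-- The vertices of the tree `T_x(s)` at depth exactly `s`. -/
def bottom (G : Digraph (Fin n)) (s : ℕ) (θ : ℝ)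
    (tie : Finset (Fin n × Fin n) → Fin n × Fin n) (x : Fin n) : Finset (Fin n) :=
  (finalState G s θ tie x).verts.filter
    fun v => ((finalState G s θ tie x).path v).length = s + 1

/-- Mass of the path from the root to `v` in the tree `T_x(s)`. -/
def treeMass (G : Digraph (Fin n)) (s : ℕ) (θ : ℝ)
    (tie : Finset (Fin n × Fin n) → Fin n × Fin n) (x v : Fin n) : ℝ :=
  mass G ((finalState G s θ tie x).path v)

lemma treeInv_finalState (htie : ∀ S, S.Nonempty → tie S ∈ S) :
    TreeInv G x (finalState G s θ tie x) := treeInv_iterate htie _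

lemma iterate_step_congr (htie : ∀ S, S.Nonempty → tie S ∈ S) (N : ℕ)
    (hrow : ∀ v, ¬ (v ∈ ((step G s θ tie)^[N] (initState x)).verts ∧
      (((step G s θ tie)^[N] (initState x)).path v).length = s + 1) → SameRow G G' v)
    (k : ℕ) (hk : k ≤ N) :
    (step G' s θ tie)^[k] (initState x) = (step G s θ tie)^[k] (initState x) := by
  induction k with
  | zero => rw [Function.iterate_zero_apply, Function.iterate_zero_apply]
  | succ k ih =>
    rw [Function.iterate_succ_apply', Function.iterate_succ_apply', ih (by omega)]
    symm
    refine step_congr (treeInv_iterate htie k) fun v hv hlen => hrow v fun hb => ?_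
    have h1 := path_iterate (G := G) (s := s) (θ := θ) htie hv (N - k)
    rw [← Function.iterate_add_apply, Nat.sub_add_cancel (by omega)] at h1
    have h2 := hb.2
    rw [h1.2] at h2
    omega

/-- The exploration never looks at the rows of the vertices at depth `s`. -/
lemma finalState_congr (htie : ∀ S, S.Nonempty → tie S ∈ S)
    (hrow : ∀ v ∉ bottom G s θ tie x, SameRow G G' v) :
    finalState G' s θ tie x = finalState G s θ tie x := by
  unfold finalState
  refine iterate_step_congr htie (n * n) (fun v hv => hrow v fun hb => hv ?_) (n * n) (le_refl _)
  exact Finset.mem_filter.1 hb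

lemma bottom_congr (htie : ∀ S, S.Nonempty → tie S ∈ S)
    (hrow : ∀ v ∉ bottom G s θ tie x, SameRow G G' v) :
    bottom G' s θ tie x = bottom G s θ tie x := by
  unfold bottom
  rw [finalState_congr htie hrow]

lemma treeMass_congr (htie : ∀ S, S.Nonempty → tie S ∈ S)
    (hrow : ∀ v ∉ bottom G s θ tie x, SameRow G G' v) {u : Fin n}
    (hu : u ∈ bottom G s θ tie x) :
    treeMass G' s θ tie x u = treeMass G s θ tie x u := by
  unfold treeMass
  rw [finalState_congr htie hrow]
  obtain ⟨hu1, hu2⟩ := Finset.mem_filter.1 hu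
  obtain ⟨l, hl, hl'⟩ := (treeInv_finalState (G := G) (s := s) (θ := θ) (x := x) htie).path_eq u hu1
  rw [hl]
  refine (mass_concat_congr l u fun a ha => hrow a fun hb => ?_).symm
  have h1 := (Finset.mem_filter.1 hb).2
  have h2 := (hl' a ha).2
  omega

lemma isPath_of_mem_bottom (htie : ∀ S, S.Nonempty → tie S ∈ S) {u : Fin n}
    (hu : u ∈ bottom G s θ tie x) : IsPath G x u s ((finalState G s θ tie x).path u) := by
  obtain ⟨hu1, hu2⟩ := Finset.mem_filter.1 hu
  have h := treeInv_finalState (G := G) (s := s) (θ := θ) (x := x) htie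
  obtain ⟨l, hl, -⟩ := h.path_eq u hu1
  exact ⟨hu2, h.head_path u hu1, by rw [hl]; simp, h.chain_path u hu1⟩

lemma path_of_isChain_tree (h : TreeInv G x σ) (l : List (Fin n)) (a : Fin n) (ha : a ∈ σ.verts)
    (hl : (a :: l).IsChain fun a b => (a, b) ∈ σ.tree) (v : Fin n)
    (hv : (a :: l).getLast? = some v) : v ∈ σ.verts ∧ σ.path v = σ.path a ++ l := by
  induction l generalizing a with
  | nil =>
    simp at hv
    subst hv
    exact ⟨ha, by simp⟩
  | cons b l ih =>
    rw [List.isChain_cons_cons] at hl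
    obtain ⟨-, hb, hp⟩ := h.tree_edge a b hl.1
    have := ih b hb hl.2 (by simpa using hv)
    exact ⟨this.1, by rw [this.2, hp]; simp⟩

/-- A list of `s + 1` vertices starting at the root and following tree edges is the tree path to
its last vertex, which lies at depth `s`. -/
lemma mem_bottom_of_isChain_tree (htie : ∀ S, S.Nonempty → tie S ∈ S) {l : List (Fin n)}
    (hx : l.head? = some x) (hlen : l.length = s + 1)
    (hl : l.IsChain fun a b => (a, b) ∈ treeEdges G s θ tie x) {u : Fin n}
    (hu : l.getLast? = some u) :
    u ∈ bottom G s θ tie x ∧ (finalState G s θ tie x).path u = l := by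
  have h := treeInv_finalState (G := G) (s := s) (θ := θ) (x := x) htie
  cases l with
  | nil => simp at hx
  | cons a l =>
    simp at hx
    subst hx
    obtain ⟨h1, h2⟩ := path_of_isChain_tree h l a h.root_mem hl u hu
    rw [h.root_path] at h2
    have h3 : (finalState G s θ tie a).path u = a :: l := by simpa using h2
    exact ⟨Finset.mem_filter.2 ⟨h1, by rw [h3, hlen]⟩, h3⟩

end Tree

/-! ### Paths, masses and powers of the transition matrix -/

section Paths

variable {n : ℕ} {G : Digraph (Fin n)}

lemma walk_nonneg (G : Digraph (Fin n)) (a b : Fin n) : 0 ≤ walk G a b := by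
  unfold walk
  split_ifs <;> positivity

lemma walk_row_sum_le (G : Digraph (Fin n)) (a : Fin n) : ∑ b, walk G a b ≤ 1 := by
  classical
  have h : ∑ b, walk G a b = (outDeg G a : ℝ) * (1 / outDeg G a) := by
    simp only [walk, outDeg]
    rw [← Finset.sum_filter, Finset.sum_const, nsmul_eq_mul]
  rw [h, mul_one_div]
  exact div_self_le_one _

lemma walk_pow_nonneg (G : Digraph (Fin n)) (k : ℕ) (a b : Fin n) : 0 ≤ (walk G ^ k) a b := by
  induction k generalizing a with
  | zero => rw [pow_zero, Matrix.one_apply]; split_ifs <;> norm_num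
  | succ k ih =>
    rw [pow_succ', Matrix.mul_apply]
    exact Finset.sum_nonneg fun c _ => mul_nonneg (walk_nonneg G a c) (ih c)

lemma walk_pow_row_sum_le (G : Digraph (Fin n)) (k : ℕ) (a : Fin n) :
    ∑ b, (walk G ^ k) a b ≤ 1 := by
  induction k generalizing a with
  | zero => simp [Matrix.one_apply]
  | succ k ih =>
    simp only [pow_succ', Matrix.mul_apply]
    rw [Finset.sum_comm]
    simp only [← Finset.mul_sum]
    calc ∑ c, walk G a c * ∑ b, (walk G ^ k) c b ≤ ∑ c, walk G a c * 1 :=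
          Finset.sum_le_sum fun c _ => mul_le_mul_of_nonneg_left (ih c) (walk_nonneg G a c)
      _ ≤ 1 := by simpa using walk_row_sum_le G a

lemma mass_nonneg (G : Digraph (Fin n)) (p : List (Fin n)) : 0 ≤ mass G p := by
  induction p with
  | nil => simp [mass]
  | cons a l ih =>
    cases l with
    | nil => simp [mass]
    | cons b l => exact mul_nonneg (walk_nonneg G a b) ih

lemma isPath_zero_iff {x y : Fin n} {p : List (Fin n)} :
    IsPath G x y 0 p ↔ p = [x] ∧ x = y := by
  constructor
  · rintro ⟨h1, h2, h3, -⟩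
    obtain ⟨a, rfl⟩ := List.length_eq_one_iff.1 h1
    simp at h2 h3
    exact ⟨by rw [h2], by rw [← h2, h3]⟩
  · rintro ⟨rfl, rfl⟩
    simp [IsPath]

lemma isPath_succ_iff {x y : Fin n} {k : ℕ} {p : List (Fin n)} :
    IsPath G x y (k + 1) p ↔ ∃ b l, p = x :: l ∧ G.Adj x b ∧ IsPath G b y k l := by
  constructor
  · rintro ⟨h1, h2, h3, h4⟩
    match p, h1, h2, h3, h4 with
    | a :: b :: l, h1, h2, h3, h4 =>
      rw [List.isChain_cons_cons] at h4
      simp at h2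
      subst h2
      exact ⟨b, b :: l, rfl, h4.1, by simpa using h1, rfl, by simpa using h3, h4.2⟩
  · rintro ⟨b, l, rfl, hab, h1, h2, h3, h4⟩
    match l, h1, h2, h3, h4 with
    | c :: l, h1, h2, h3, h4 =>
      simp at h2
      subst h2
      exact ⟨by simpa using h1, rfl, by simpa using h3, List.isChain_cons_cons.2 ⟨hab, h4⟩⟩

lemma IsPath.mass_cons {x b y : Fin n} {k : ℕ} {l : List (Fin n)} (h : IsPath G b y k l) :
    mass G (x :: l) = walk G x b * mass G l := by
  obtain ⟨-, h2, -, -⟩ := h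
  cases l with
  | nil => simp at h2
  | cons c l =>
    simp at h2
    subst h2
    rfl

lemma IsPath.mass_le_walk_pow {x y : Fin n} {k : ℕ} {p : List (Fin n)} (h : IsPath G x y k p) :
    mass G p ≤ (walk G ^ k) x y := by
  induction k generalizing x p with
  | zero =>
    obtain ⟨rfl, rfl⟩ := isPath_zero_iff.1 h
    simp [mass]
  | succ k ih =>
    obtain ⟨b, l, rfl, hab, hl⟩ := isPath_succ_iff.1 h
    rw [hl.mass_cons, pow_succ', Matrix.mul_apply]
    calc walk G x b * mass G l ≤ walk G x b * (walk G ^ k) b y :=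
          mul_le_mul_of_nonneg_left (ih hl) (walk_nonneg G x b)
      _ ≤ _ := Finset.single_le_sum (f := fun c => walk G x c * (walk G ^ k) c y)
          (fun c _ => mul_nonneg (walk_nonneg G x c) (walk_pow_nonneg G k c y))
          (Finset.mem_univ b)

lemma exists_isPath_of_walk_pow_ne_zero {x y : Fin n} {k : ℕ} (h : (walk G ^ k) x y ≠ 0) :
    ∃ p, IsPath G x y k p := by
  induction k generalizing x with
  | zero =>
    by_cases hxy : x = y
    · exact ⟨[x], isPath_zero_iff.2 ⟨rfl, hxy⟩⟩
    · simp [hxy] at h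
  | succ k ih =>
    rw [pow_succ', Matrix.mul_apply] at h
    obtain ⟨b, -, hb⟩ := Finset.exists_ne_zero_of_sum_ne_zero h
    obtain ⟨l, hl⟩ := ih (right_ne_zero_of_mul hb)
    have hab : G.Adj x b := by
      by_contra hab
      exact left_ne_zero_of_mul hb (by simp [walk, hab])
    exact ⟨x :: l, isPath_succ_iff.2 ⟨b, l, rfl, hab, hl⟩⟩

/-- If `p` is the only path of its length between its endpoints, it carries the whole transition
probability. -/
lemma IsPath.walk_pow_le_mass {x y : Fin n} {k : ℕ} {p : List (Fin n)} (h : IsPath G x y k p)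
    (huniq : ∀ q, IsPath G x y k q → q = p) : (walk G ^ k) x y ≤ mass G p := by
  induction k generalizing x p with
  | zero =>
    obtain ⟨rfl, rfl⟩ := isPath_zero_iff.1 h
    simp [mass]
  | succ k ih =>
    obtain ⟨b, l, rfl, hab, hl⟩ := isPath_succ_iff.1 h
    have huniq' : ∀ c q, G.Adj x c → IsPath G c y k q → q = l := fun c q hc hq => by
      have := huniq (x :: q) (isPath_succ_iff.2 ⟨c, q, rfl, hc, hq⟩)
      simpa using this
    rw [hl.mass_cons, pow_succ', Matrix.mul_apply, Finset.sum_eq_single b]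
    · exact mul_le_mul_of_nonneg_left (ih hl fun q hq => huniq' b q hab hq) (walk_nonneg G x b)
    · intro c _ hc
      by_contra hne
      obtain ⟨q, hq⟩ := exists_isPath_of_walk_pow_ne_zero (right_ne_zero_of_mul hne)
      have hac : G.Adj x c := by
        by_contra hac
        exact left_ne_zero_of_mul hne (by simp [walk, hac])
      have hql := huniq' c q hac hq
      subst hql
      have := hq.2.1.symm.trans hl.2.1
      simp at this
      exact hc this
    · simp

lemma mass_append (l : List (Fin n)) (u v : Fin n) (l' : List (Fin n)) :
    mass G ((l ++ [u]) ++ v :: l') = mass G (l ++ [u]) * walk G u v * mass G (v :: l') := by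
  induction l with
  | nil => simp [mass]
  | cons a l ih =>
    cases l with
    | nil => simp [mass]; ring
    | cons b l =>
      simp only [List.cons_append, mass] at ih ⊢
      rw [ih]; ring

lemma IsPath.mass_le_pow {x y : Fin n} {k : ℕ} {p : List (Fin n)} (h : IsPath G x y k p)
    {d : ℝ} (hd : 0 < d) (hdeg : ∀ a, d ≤ outDeg G a) : mass G p ≤ (1 / d) ^ k := by
  induction k generalizing x p with
  | zero =>
    obtain ⟨rfl, rfl⟩ := isPath_zero_iff.1 h
    simp [mass]
  | succ k ih =>
    obtain ⟨b, l, rfl, hab, hl⟩ := isPath_succ_iff.1 h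
    rw [hl.mass_cons, pow_succ']
    refine mul_le_mul ?_ (ih hl) (mass_nonneg G l) (by positivity)
    simp only [walk, hab, if_true]
    exact one_div_le_one_div_of_le hd (hdeg x)

end Paths

/-! ### In-neighbourhoods of a vertex -/

section Near

variable {n : ℕ} {G G' : Digraph (Fin n)} {y : Fin n}

open scoped Classical in
/-- The vertices from which `y` can be reached in fewer than `k` steps. -/
def near (G : Digraph (Fin n)) (y : Fin n) : ℕ → Finset (Fin n)
  | 0 => ∅
  | k + 1 => insert y (Finset.univ.filter fun z => ∃ v ∈ near G y k, G.Adj z v)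

/-- The vertices at distance exactly `k` to `y`. -/
def sphere (G : Digraph (Fin n)) (y : Fin n) (k : ℕ) : Finset (Fin n) :=
  near G y (k + 1) \ near G y k

lemma mem_near_succ {k : ℕ} {z : Fin n} :
    z ∈ near G y (k + 1) ↔ z = y ∨ ∃ v ∈ near G y k, G.Adj z v := by
  simp [near]

lemma near_mono_succ (G : Digraph (Fin n)) (y : Fin n) (k : ℕ) :
    near G y k ⊆ near G y (k + 1) := by
  induction k with
  | zero => simp [near]
  | succ k ih =>
    intro z hz
    rw [mem_near_succ] at hz ⊢
    exact hz.imp_right fun ⟨v, hv, hzv⟩ => ⟨v, ih hv, hzv⟩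

lemma near_mono (G : Digraph (Fin n)) (y : Fin n) : Monotone (near G y) :=
  monotone_nat_of_le_succ (near_mono_succ G y)

lemma near_congr {k : ℕ} (h : ∀ v ∈ near G y k, ∀ z, G.Adj z v ↔ G'.Adj z v) (j : ℕ)
    (hj : j ≤ k + 1) : near G' y j = near G y j := by
  induction j with
  | zero => rfl
  | succ j ih =>
    ext z
    rw [mem_near_succ, mem_near_succ, ih (by omega)]
    refine or_congr_right (exists_congr fun v => and_congr_right fun hv => ?_)
    exact (h v (near_mono G y (by omega) hv) z).symm

/-- The sphere of radius `k` does not depend on the edges into it. -/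
lemma sphere_congr {k : ℕ} (h : ∀ v ∉ sphere G y k, ∀ z, G.Adj z v ↔ G'.Adj z v) :
    sphere G' y k = sphere G y k := by
  have h' : ∀ v ∈ near G y k, ∀ z, G.Adj z v ↔ G'.Adj z v := fun v hv =>
    h v fun hs => (Finset.mem_sdiff.1 hs).2 hv
  unfold sphere
  rw [near_congr h' _ le_rfl, near_congr h' _ (by omega)]

lemma exists_adj_of_mem_sphere_succ {k : ℕ} {z : Fin n} (hz : z ∈ sphere G y (k + 1)) :
    ∃ v ∈ sphere G y k, G.Adj z v := by
  obtain ⟨h1, h2⟩ := Finset.mem_sdiff.1 hz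
  rw [mem_near_succ] at h1 h2
  rw [not_or] at h2
  obtain ⟨v, hv, hzv⟩ := h1.resolve_left h2.1
  exact ⟨v, Finset.mem_sdiff.2 ⟨hv, fun hv' => h2.2 ⟨v, hv', hzv⟩⟩, hzv⟩

lemma IsPath.mem_near {z : Fin n} {j k : ℕ} (hjk : j < k) {p : List (Fin n)}
    (h : IsPath G z y j p) : z ∈ near G y k := by
  induction j generalizing z k p with
  | zero =>
    obtain ⟨k, rfl⟩ := Nat.exists_eq_succ_of_ne_zero (by omega : k ≠ 0)
    exact mem_near_succ.2 (Or.inl (isPath_zero_iff.1 h).2)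
  | succ j ih =>
    obtain ⟨k, rfl⟩ := Nat.exists_eq_succ_of_ne_zero (by omega : k ≠ 0)
    obtain ⟨b, l, -, hab, hl⟩ := isPath_succ_iff.1 h
    exact mem_near_succ.2 (Or.inr ⟨b, ih (by omega) hl, hab⟩)

lemma exists_isPath_of_mem_near {z : Fin n} {k : ℕ} (h : z ∈ near G y k) :
    ∃ j < k, ∃ p, IsPath G z y j p := by
  induction k generalizing z with
  | zero => simp [near] at h
  | succ k ih =>
    rcases mem_near_succ.1 h with rfl | ⟨v, hv, hzv⟩
    · exact ⟨0, by omega, [z], isPath_zero_iff.2 ⟨rfl, rfl⟩⟩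
    · obtain ⟨j, hj, p, hp⟩ := ih hv
      exact ⟨j + 1, by omega, z :: p, isPath_succ_iff.2 ⟨v, p, rfl, hzv, hp⟩⟩

/-- The start of a path which is unique among the paths of length at most `h` lies at distance
exactly `h`. -/
lemma IsPath.mem_sphere {v : Fin n} {h : ℕ} {q : List (Fin n)} (hq : IsPath G v y h q)
    (huniq : ∀ k ≤ h, ∀ q', IsPath G v y k q' → q' = q) : v ∈ sphere G y h := by
  refine Finset.mem_sdiff.2 ⟨hq.mem_near (Nat.lt_succ_self h), fun hv => ?_⟩
  obtain ⟨j, hj, p, hp⟩ := exists_isPath_of_mem_near hv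
  have h1 := hp.1
  rw [huniq j hj.le p hp, hq.1] at h1
  omega

/-- The graph `G` without the edges into `S`. -/
def cut (G : Digraph (Fin n)) (S : Finset (Fin n)) : Digraph (Fin n) where
  Adj a b := G.Adj a b ∧ b ∉ S

/-- A path to `y` enters the sphere of radius `h` at no time after its start, unless it is longer
than `h`. -/
lemma IsPath.isPath_cut {v : Fin n} {j h : ℕ} (hj : j ≤ h) {q : List (Fin n)}
    (hq : IsPath G v y j q) : IsPath (cut G (sphere G y h)) v y j q := by
  induction j generalizing v q with
  | zero => exact isPath_zero_iff.2 (isPath_zero_iff.1 hq)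
  | succ j ih =>
    obtain ⟨b, l, rfl, hab, hl⟩ := isPath_succ_iff.1 hq
    refine isPath_succ_iff.2 ⟨b, l, rfl, ⟨hab, fun hb => ?_⟩, ih (by omega) hl⟩
    exact (Finset.mem_sdiff.1 hb).2 (hl.mem_near (by omega))

lemma outDeg_cut_le (G : Digraph (Fin n)) (S : Finset (Fin n)) (a : Fin n) :
    outDeg (cut G S) a ≤ outDeg G a := by
  classical
  unfold outDeg
  refine Finset.card_le_card fun b hb => ?_
  simp only [Finset.mem_filter, Finset.mem_univ, true_and] at hb ⊢
  exact hb.1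

open scoped Classical in
lemma outDeg_le_outDeg_cut_add (G : Digraph (Fin n)) (S : Finset (Fin n)) (a : Fin n) :
    outDeg G a ≤ outDeg (cut G S) a + (S.filter fun b => G.Adj a b).card := by
  unfold outDeg
  refine (Finset.card_le_card fun b hb => ?_).trans (Finset.card_union_le _ _)
  simp only [Finset.mem_filter, Finset.mem_univ, true_and, Finset.mem_union] at hb ⊢
  by_cases hS : b ∈ S
  · exact Or.inr ⟨hS, hb⟩
  · exact Or.inl ⟨hb, hS⟩

lemma outDeg_pos {a b : Fin n} (h : G.Adj a b) : 0 < outDeg G a := by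
  classical
  unfold outDeg
  exact Finset.card_pos.2 ⟨b, by simpa using h⟩

lemma walk_le_walk_cut {S : Finset (Fin n)} {a b : Fin n} (h : (cut G S).Adj a b) :
    walk G a b ≤ walk (cut G S) a b := by
  simp only [walk, h, h.1, if_true]
  exact one_div_le_one_div_of_le (by exact_mod_cast outDeg_pos h)
    (by exact_mod_cast outDeg_cut_le G S a)

lemma IsPath.mass_le_mass_cut {S : Finset (Fin n)} {v : Fin n} {k : ℕ} {q : List (Fin n)}
    (hq : IsPath (cut G S) v y k q) : mass G q ≤ mass (cut G S) q := by
  induction k generalizing v q with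
  | zero =>
    obtain ⟨rfl, rfl⟩ := isPath_zero_iff.1 hq
    simp [mass]
  | succ k ih =>
    obtain ⟨b, l, rfl, hab, hl⟩ := isPath_succ_iff.1 hq
    rw [hl.mass_cons]
    have h2 : mass G (v :: l) = walk G v b * mass G l := by
      obtain ⟨-, h2, -, -⟩ := hl
      cases l with
      | nil => simp at h2
      | cons c l => simp at h2; subst h2; rfl
    rw [h2]
    exact mul_le_mul (walk_le_walk_cut hab) (ih hl) (mass_nonneg G l) (walk_nonneg _ _ _)

lemma walk_cut_le {S : Finset (Fin n)} {r : ℝ}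
    (hr : ∀ a, (outDeg G a : ℝ) ≤ r * outDeg (cut G S) a) (a b : Fin n) :
    walk (cut G S) a b ≤ r * walk G a b := by
  by_cases h : (cut G S).Adj a b
  · have h1 : (0 : ℝ) < outDeg (cut G S) a := by exact_mod_cast outDeg_pos h
    have h2 : (0 : ℝ) < outDeg G a := by exact_mod_cast outDeg_pos h.1
    simp only [walk, h, h.1, if_true]
    rw [mul_one_div, div_le_div_iff₀ h1 h2, one_mul]
    exact hr a
  · by_cases hG : G.Adj a b
    · have h2 : (0 : ℝ) < outDeg G a := by exact_mod_cast outDeg_pos hG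
      have h3 := hr a
      have h4 : 0 ≤ r := by
        by_contra hneg
        have : r * (outDeg (cut G S) a : ℝ) ≤ 0 :=
          mul_nonpos_of_nonpos_of_nonneg (by linarith) (by positivity)
        linarith
      simp only [walk, h, hG, if_true, if_false]
      positivity
    · simp [walk, h, hG]

lemma walk_cut_pow_le {S : Finset (Fin n)} {r : ℝ} (hr0 : 0 ≤ r)
    (hr : ∀ a, (outDeg G a : ℝ) ≤ r * outDeg (cut G S) a) (k : ℕ) (a b : Fin n) :
    (walk (cut G S) ^ k) a b ≤ r ^ k * (walk G ^ k) a b := by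
  induction k generalizing a with
  | zero => simp
  | succ k ih =>
    simp only [pow_succ' (walk _), Matrix.mul_apply, Finset.mul_sum]
    refine Finset.sum_le_sum fun c _ => ?_
    calc walk (cut G S) a c * (walk (cut G S) ^ k) c b
        ≤ (r * walk G a c) * (r ^ k * (walk G ^ k) c b) :=
          mul_le_mul (walk_cut_le hr a c) (ih c) (walk_pow_nonneg _ _ _ _)
            (mul_nonneg hr0 (walk_nonneg _ _ _))
      _ = _ := by ring

end Near

/-! ### Nice paths cross a fresh edge -/

section Nice

variable {n : ℕ} {G : Digraph (Fin n)} {s h : ℕ} {θ : ℝ}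
  {tie : Finset (Fin n × Fin n) → Fin n × Fin n} {x : Fin n}

lemma treeMass_nonneg (u : Fin n) : 0 ≤ treeMass G s θ tie x u := mass_nonneg _ _

lemma sum_treeMass_le (htie : ∀ S, S.Nonempty → tie S ∈ S) :
    ∑ u ∈ bottom G s θ tie x, treeMass G s θ tie x u ≤ 1 :=
  calc ∑ u ∈ bottom G s θ tie x, treeMass G s θ tie x u
      ≤ ∑ u ∈ bottom G s θ tie x, (walk G ^ s) x u :=
        Finset.sum_le_sum fun _ hu => (isPath_of_mem_bottom htie hu).mass_le_walk_pow
    _ ≤ ∑ u, (walk G ^ s) x u :=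
        Finset.sum_le_sum_of_subset_of_nonneg (Finset.subset_univ _)
          fun u _ _ => walk_pow_nonneg G s x u
    _ ≤ 1 := walk_pow_row_sum_le G s x

/-- Mass carried by the edge `u → v` towards `y`, when `u` is at depth `s` in the tree of `x` and
`v` lies on the sphere of radius `h` around `y`. The edges into that sphere are disregarded in the
out-degrees, so that this weight does not depend on them. -/
def crossWeight (G : Digraph (Fin n)) (s h : ℕ) (θ : ℝ)
    (tie : Finset (Fin n × Fin n) → Fin n × Fin n) (x y u v : Fin n) : ℝ :=
  treeMass G s θ tie x u * (1 / (outDeg (cut G (sphere G y h)) u : ℝ)) *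
    (walk (cut G (sphere G y h)) ^ h) v y

/-- The weight `crossWeight`, set to `0` when it exceeds `b`. -/
def truncWeight (G : Digraph (Fin n)) (s h : ℕ) (θ : ℝ)
    (tie : Finset (Fin n × Fin n) → Fin n × Fin n) (x y : Fin n) (b : ℝ) (u v : Fin n) : ℝ :=
  if crossWeight G s h θ tie x y u v ≤ b then crossWeight G s h θ tie x y u v else 0

lemma crossWeight_nonneg (y u v : Fin n) : 0 ≤ crossWeight G s h θ tie x y u v :=
  mul_nonneg (mul_nonneg (treeMass_nonneg u) (by positivity)) (walk_pow_nonneg _ _ _ _)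

lemma truncWeight_nonneg (y : Fin n) (b : ℝ) (u v : Fin n) :
    0 ≤ truncWeight G s h θ tie x y b u v := by
  unfold truncWeight
  split_ifs
  · exact crossWeight_nonneg y u v
  · exact le_rfl

lemma truncWeight_le_crossWeight (y : Fin n) (b : ℝ) (u v : Fin n) :
    truncWeight G s h θ tie x y b u v ≤ crossWeight G s h θ tie x y u v := by
  unfold truncWeight
  split_ifs
  · exact le_rfl
  · exact crossWeight_nonneg y u v

lemma truncWeight_le {b : ℝ} (hb : 0 ≤ b) (y u v : Fin n) :
    truncWeight G s h θ tie x y b u v ≤ b := by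
  unfold truncWeight
  split_ifs with h
  · exact h
  · exact hb

/-- Decomposition of a nice path at its `s`-th edge `u → v`. The path is determined by that edge,
and its mass is at most the weight of the edge. -/
lemma IsNice.decomp {C r : ℝ} {y : Fin n} (htie : ∀ S, S.Nonempty → tie S ∈ S)
    (hr1 : 1 ≤ r) (hr2 : r ^ (h + 1) ≤ 2)
    (hr : ∀ a, (outDeg G a : ℝ) ≤ r * outDeg (cut G (sphere G y h)) a)
    {p : List (Fin n)} (hp : IsNice G s h θ C tie x y p) {u v : Fin n}
    (hu : p[s]? = some u) (hv : p[s + 1]? = some v) :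
    u ∈ bottom G s θ tie x ∧ v ∈ sphere G y h ∧ G.Adj u v ∧
      (finalState G s θ tie x).path u = p.take (s + 1) ∧
      IsPath G v y h (p.drop (s + 1)) ∧
      mass G p ≤ truncWeight G s h θ tie x y (2 / (n * Real.log n ^ 3)) u v := by
  obtain ⟨⟨hlen, hhead, hlast, hchain⟩, hmass, htree, huniq, -⟩ := hp
  have huniq := huniq v hv
  obtain ⟨hs1, hu'⟩ := List.getElem?_eq_some_iff.1 hu
  obtain ⟨hs2, hv'⟩ := List.getElem?_eq_some_iff.1 hv
  have htake : p.take (s + 1) = p.take s ++ [u] := by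
    rw [List.take_add_one, hu]; rfl
  have hdrop : p.drop (s + 1) = v :: p.drop (s + 1 + 1) := by
    rw [List.drop_eq_getElem_cons hs2, hv']
  have hp_eq : p = (p.take s ++ [u]) ++ v :: p.drop (s + 1 + 1) := by
    rw [← htake, ← hdrop, List.take_append_drop]
  have hadj : G.Adj u v := by
    have h1 := hchain
    rw [hp_eq, List.isChain_append] at h1
    exact h1.2.2 u (by simp) v (by simp)
  have htail : IsPath G v y h (p.drop (s + 1)) := by
    refine ⟨by rw [List.length_drop, hlen]; omega, by rw [hdrop]; rfl, ?_, hchain.drop _⟩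
    rw [List.getLast?_drop, if_neg (by omega), hlast]
  obtain ⟨hub, hpath⟩ := mem_bottom_of_isChain_tree (l := p.take (s + 1)) (u := u) htie
    (by rw [List.head?_take, if_neg (by omega), hhead])
    (by rw [List.length_take, hlen]; omega) htree (by rw [htake]; simp)
  have hvs : v ∈ sphere G y h := htail.mem_sphere huniq
  refine ⟨hub, hvs, hadj, hpath, htail, ?_⟩
  have hcut := htail.isPath_cut le_rfl
  set S := sphere G y h with hS
  have hmp : mass G p = treeMass G s θ tie x u * (1 / (outDeg G u : ℝ)) *
      mass G (p.drop (s + 1)) := by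
    conv_lhs => rw [hp_eq]
    rw [mass_append, ← hdrop, ← htake, treeMass, hpath]
    simp [walk, hadj]
  have hr0 : (0 : ℝ) < r := by linarith
  have hD : (0 : ℝ) < outDeg G u := by exact_mod_cast outDeg_pos hadj
  have hDr := hr u
  have hD' : (0 : ℝ) < outDeg (cut G S) u := by
    by_contra hneg
    have := mul_nonpos_of_nonneg_of_nonpos hr0.le (not_lt.1 hneg)
    linarith
  have hD1 : 1 / (outDeg G u : ℝ) ≤ 1 / (outDeg (cut G S) u : ℝ) :=
    one_div_le_one_div_of_le hD' (by exact_mod_cast outDeg_cut_le G S u)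
  have hD2 : 1 / (outDeg (cut G S) u : ℝ) ≤ r * (1 / (outDeg G u : ℝ)) := by
    rw [mul_one_div, div_le_div_iff₀ hD' hD, one_mul]
    exact hDr
  have hT := treeMass_nonneg (G := G) (s := s) (θ := θ) (tie := tie) (x := x) u
  have hq1 : mass G (p.drop (s + 1)) ≤ (walk (cut G S) ^ h) v y :=
    hcut.mass_le_mass_cut.trans hcut.mass_le_walk_pow
  have hq2 : (walk (cut G S) ^ h) v y ≤ r ^ h * mass G (p.drop (s + 1)) :=
    (walk_cut_pow_le hr0.le hr h v y).trans (mul_le_mul_of_nonneg_left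
      (htail.walk_pow_le_mass fun q hq => huniq h le_rfl q hq) (by positivity))
  have hle : mass G p ≤ crossWeight G s h θ tie x y u v := by
    rw [hmp]
    exact mul_le_mul (mul_le_mul_of_nonneg_left hD1 hT) hq1 (mass_nonneg _ _)
      (mul_nonneg hT (by positivity))
  have hge : crossWeight G s h θ tie x y u v ≤ 2 / (n * Real.log n ^ 3) := by
    calc crossWeight G s h θ tie x y u v
        ≤ treeMass G s θ tie x u * (r * (1 / (outDeg G u : ℝ))) *
            (r ^ h * mass G (p.drop (s + 1))) :=
          mul_le_mul (mul_le_mul_of_nonneg_left hD2 hT) hq2 (walk_pow_nonneg _ _ _ _)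
            (mul_nonneg hT (by positivity))
      _ = r ^ (h + 1) * mass G p := by rw [hmp]; ring
      _ ≤ 2 * (1 / (n * Real.log n ^ 3)) :=
          mul_le_mul hr2 hmass (mass_nonneg _ _) (by norm_num)
      _ = 2 / (n * Real.log n ^ 3) := by ring
  rw [truncWeight, if_pos hge]
  exact hle

open scoped Classical in
/-- The probability of the nice paths is at most the total weight of the edges from the bottom of
the tree of `x` to the sphere around `y`. -/
lemma niceProb_le {C r : ℝ} {y : Fin n} (htie : ∀ S, S.Nonempty → tie S ∈ S)
    (hr1 : 1 ≤ r) (hr2 : r ^ (h + 1) ≤ 2)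
    (hr : ∀ a, (outDeg G a : ℝ) ≤ r * outDeg (cut G (sphere G y h)) a) :
    niceProb G s h θ C tie x y ≤ ∑ e ∈ bottom G s θ tie x ×ˢ sphere G y h,
      if G.Adj e.1 e.2 then truncWeight G s h θ tie x y (2 / (n * Real.log n ^ 3)) e.1 e.2
      else 0 := by
  set g : Fin n × Fin n → ℝ := fun e => if G.Adj e.1 e.2 then
    truncWeight G s h θ tie x y (2 / (n * Real.log n ^ 3)) e.1 e.2 else 0 with hg
  let φ : List.Vector (Fin n) (s + h + 2) → Fin n × Fin n := fun p =>
    (p.toList[s]'(by simp; omega), p.toList[s + 1]'(by simp))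
  set N := Finset.univ.filter fun p : List.Vector (Fin n) (s + h + 2) =>
    IsNice G s h θ C tie x y p.toList with hN
  have hdec : ∀ p ∈ N, _ := fun p hp =>
    ((Finset.mem_filter.1 hp).2).decomp htie hr1 hr2 hr (u := (φ p).1) (v := (φ p).2)
      (List.getElem?_eq_getElem _) (List.getElem?_eq_getElem _)
  have hinj : Set.InjOn φ N := by
    intro p hp p' hp' hpp
    obtain ⟨-, -, -, h1, h2, -⟩ := hdec p hp
    obtain ⟨-, -, -, h1', h2', -⟩ := hdec p' hp'
    rw [← hpp] at h1' h2'
    have htake : p.toList.take (s + 1) = p'.toList.take (s + 1) := h1.symm.trans h1'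
    have hdrop : p'.toList.drop (s + 1) = p.toList.drop (s + 1) :=
      (Finset.mem_filter.1 hp).2.2.2.2.1 (φ p).2 (List.getElem?_eq_getElem _) h le_rfl _ h2'
    apply List.Vector.toList_injective
    rw [← List.take_append_drop (s + 1) p.toList, htake, ← hdrop, List.take_append_drop]
  calc niceProb G s h θ C tie x y = ∑ p ∈ N, mass G p.toList := by
        rw [niceProb, hN, Finset.sum_filter]
    _ ≤ ∑ p ∈ N, g (φ p) := by
        refine Finset.sum_le_sum fun p hp => ?_
        obtain ⟨-, -, hadj, -, -, hm⟩ := hdec p hp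
        simp only [hg, hadj, if_true]
        exact hm
    _ = ∑ e ∈ N.image φ, g e := (Finset.sum_image hinj).symm
    _ ≤ _ := by
        refine Finset.sum_le_sum_of_subset_of_nonneg ?_ fun e _ _ => ?_
        · intro e he
          obtain ⟨p, hp, rfl⟩ := Finset.mem_image.1 he
          obtain ⟨h1, h2, -⟩ := hdec p hp
          exact Finset.mem_product.2 ⟨h1, h2⟩
        · simp only [hg]
          split_ifs
          · exact truncWeight_nonneg _ _ _ _
          · exact le_rfl

end Nice

/-! ### Edge probabilities and out-degrees -/

section Degrees

variable {n : ℕ} {wp wm : Fin n → ℝ}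

lemma exp_sub_one_le_mul {δ x : ℝ} (h0 : 0 ≤ x) (hδ : x ≤ δ) (h1 : x ≤ 1) :
    Real.exp x - 1 ≤ (1 + δ) * x := by
  have := (abs_le.1 (Real.abs_exp_sub_one_sub_id_le (x := x) (by rwa [abs_of_nonneg h0]))).2
  nlinarith

/-- The mean `w_x^+ 𝐰 log n / n` of the out-degree of `x`, up to the truncation of the edge
probabilities at `1` and the missing loop. -/
def meanDeg (wp wm : Fin n → ℝ) (x : Fin n) : ℝ := wp x * (∑ z, wm z) * (Real.log n / n)

lemma log_div_nonneg (n : ℕ) : 0 ≤ Real.log n / (n : ℝ) :=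
  div_nonneg (Real.log_natCast_nonneg n) (Nat.cast_nonneg n)

lemma sum_wm_pos (hm : ∀ x, 0 < wm x) (y : Fin n) : 0 < ∑ z, wm z :=
  Finset.sum_pos (fun z _ => hm z) ⟨y, Finset.mem_univ y⟩

lemma meanDeg_nonneg (hp : ∀ x, 0 ≤ wp x) (hm : ∀ x, 0 < wm x) (x : Fin n) :
    0 ≤ meanDeg wp wm x :=
  mul_nonneg (mul_nonneg (hp x) (sum_wm_pos hm x).le) (log_div_nonneg n)

lemma muIn_nonneg (hm : ∀ x, 0 < wm x) (x : Fin n) : 0 ≤ muIn wm x :=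
  div_nonneg (hm x).le (sum_wm_pos hm x).le

lemma sum_muIn (hm : ∀ x, 0 < wm x) (hn : 0 < n) : ∑ x, muIn wm x = 1 := by
  simp only [muIn]
  rw [← Finset.sum_div]
  exact div_self (sum_wm_pos hm ⟨0, hn⟩).ne'

lemma edgeProb_le (x y : Fin n) : edgeProb wp wm x y ≤ wp x * wm y * (Real.log n / n) :=
  min_le_left _ _

lemma edgeProb_le_meanDeg_mul (hm : ∀ x, 0 < wm x) (x y : Fin n) :
    edgeProb wp wm x y ≤ meanDeg wp wm x * muIn wm y := by
  refine (edgeProb_le x y).trans (le_of_eq ?_)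
  have := (sum_wm_pos hm y).ne'
  rw [meanDeg, muIn]
  field_simp

/-- The out-degree of `x` as a function of the indicators of the edges out of `x`. -/
def rowDeg (x : Fin n) (r : Fin n → Bool) : ℝ :=
  ∑ y ∈ Finset.univ.erase x, if r y then 1 else 0

lemma outDeg_graph (ω : Fin n × Fin n → Bool) (x : Fin n) :
    (outDeg (graph ω) x : ℝ) = rowDeg x (fun y => ω (x, y)) := by
  classical
  rw [outDeg, rowDeg, ← Finset.sum_filter, Finset.sum_const, nsmul_eq_mul, mul_one]
  congr 2
  ext y
  rw [Finset.mem_filter, Finset.mem_filter, Finset.mem_erase]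
  have hadj : (graph ω).Adj x y ↔ x ≠ y ∧ ω (x, y) = true := Iff.rfl
  rw [hadj, ne_comm]
  simp

lemma rowDeg_eq_natCast (x : Fin n) (r : Fin n → Bool) : ∃ k : ℕ, rowDeg x r = k := by
  refine ⟨((Finset.univ.erase x).filter fun y => r y).card, ?_⟩
  rw [rowDeg, ← Finset.sum_filter, Finset.sum_const, nsmul_eq_mul, mul_one]

/-- Lower tail of the out-degree. -/
lemma prob_rowDeg_le (hp : ∀ x, 0 ≤ wp x) (hm : ∀ x, 0 < wm x) (x : Fin n) {θ d ℓ : ℝ}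
    (hθ : 0 < θ)
    (h : ℓ ≤ (∑ y ∈ Finset.univ.erase x, edgeProb wp wm x y) * (1 - Real.exp (-θ)) - θ * d) :
    prob (fun y => edgeProb wp wm x y) {r | rowDeg x r ≤ d} ≤ Real.exp (-ℓ) := by
  have hpr : ∀ y, 0 ≤ edgeProb wp wm x y ∧ edgeProb wp wm x y ≤ 1 :=
    fun y => edgeProb_mem hp (fun z => (hm z).le) x y
  refine le_trans (prob_mono hpr ?_)
    (prob_linear_ge_le hpr (Finset.univ.erase x) (fun _ => -θ) (-(θ * d)) ℓ ?_)
  · intro r hr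
    have hr' : rowDeg x r ≤ d := hr
    have : ∑ y ∈ Finset.univ.erase x, (if r y then -θ else 0) = -(θ * rowDeg x r) := by
      rw [rowDeg, Finset.mul_sum, ← Finset.sum_neg_distrib]
      refine Finset.sum_congr rfl fun y _ => ?_
      split_ifs <;> simp
    rw [Set.mem_ofPred_eq, this]
    exact neg_le_neg (mul_le_mul_of_nonneg_left hr' hθ.le)
  · rw [← Finset.sum_mul]
    linarith

lemma expect_inv_rowDeg_le (hp : ∀ x, 0 ≤ wp x) (hm : ∀ x, 0 < wm x) (x : Fin n) {δ : ℝ}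
    (hδ0 : 0 < δ) (hδ1 : δ < 1)
    (hsum : (1 - δ) * meanDeg wp wm x ≤ ∑ y ∈ Finset.univ.erase x, edgeProb wp wm x y) :
    expect (fun y => edgeProb wp wm x y) (fun r => meanDeg wp wm x / rowDeg x r)
      ≤ 1 / (1 - δ) ^ 2 +
        meanDeg wp wm x * Real.exp (-(δ ^ 2 * (1 - δ) / 4 * meanDeg wp wm x)) := by
  have hpr : ∀ y, 0 ≤ edgeProb wp wm x y ∧ edgeProb wp wm x y ≤ 1 :=
    fun y => edgeProb_mem hp (fun z => (hm z).le) x y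
  have hl := meanDeg_nonneg hp hm x
  set l := meanDeg wp wm x with hl_def
  set S : Set (Fin n → Bool) := {r | rowDeg x r ≤ (1 - δ) ^ 2 * l} with hS
  have hd : 0 < 1 - δ := by linarith
  have hpt : ∀ r, l / rowDeg x r ≤ 1 / (1 - δ) ^ 2 + l * S.indicator 1 r := by
    intro r
    obtain ⟨k, hk⟩ := rowDeg_eq_natCast x r
    by_cases hr : r ∈ S
    · rw [Set.indicator_of_mem hr, hk]
      have h1 : l / (k : ℝ) ≤ l := by
        rcases Nat.eq_zero_or_pos k with rfl | hk0
        · simpa using hl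
        · exact div_le_self hl (by exact_mod_cast hk0)
      have : 0 ≤ 1 / (1 - δ) ^ 2 := by positivity
      simp only [Pi.one_apply]
      linarith
    · rw [Set.indicator_of_notMem hr, mul_zero, add_zero]
      have h1 : (1 - δ) ^ 2 * l < rowDeg x r := not_le.1 hr
      have h2 : 0 < rowDeg x r := lt_of_le_of_lt (by positivity) h1
      rw [div_le_div_iff₀ h2 (by positivity)]
      linarith
  refine (expect_mono hpr hpt).trans ?_
  rw [expect_add, expect_const, expect_mul_left]
  gcongr
  refine prob_rowDeg_le hp hm x (θ := δ / 2) (by positivity) ?_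
  have h3 : Real.exp (-(δ / 2)) ≤ 1 - δ / 2 + (δ / 2) ^ 2 := by
    have habs : |-(δ / 2)| ≤ 1 := by
      rw [abs_neg, abs_of_pos (by positivity)]; linarith
    have := (abs_le.1 (Real.abs_exp_sub_one_sub_id_le habs)).2
    nlinarith
  have h4 : δ / 2 - (δ / 2) ^ 2 ≤ 1 - Real.exp (-(δ / 2)) := by linarith
  have h5 : 0 ≤ δ / 2 - (δ / 2) ^ 2 := by nlinarith
  calc δ ^ 2 * (1 - δ) / 4 * l
      = ((1 - δ) * l) * (δ / 2 - (δ / 2) ^ 2) - δ / 2 * ((1 - δ) ^ 2 * l) := by ring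
    _ ≤ (∑ y ∈ Finset.univ.erase x, edgeProb wp wm x y) * (1 - Real.exp (-(δ / 2)))
          - δ / 2 * ((1 - δ) ^ 2 * l) := by
        gcongr
        exact (mul_nonneg hd.le hl).trans hsum

lemma prob_exists_outDeg_le (hp : ∀ x, 0 ≤ wp x) (hm : ∀ x, 0 < wm x) {θ d ℓ : ℝ} (hθ : 0 < θ)
    (h : ∀ x, ℓ ≤ (∑ y ∈ Finset.univ.erase x, edgeProb wp wm x y) * (1 - Real.exp (-θ)) - θ * d) :
    prob (fun e => edgeProb wp wm e.1 e.2) (⋃ x, {ω | (outDeg (graph ω) x : ℝ) ≤ d})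
      ≤ n * Real.exp (-ℓ) := by
  have := prob_iUnion_le_card_mul (fun e => edgeProb_mem hp (fun z => (hm z).le) e.1 e.2)
    (fun x : Fin n => {ω : Fin n × Fin n → Bool | (outDeg (graph ω) x : ℝ) ≤ d})
    (b := Real.exp (-ℓ)) fun x => ?_
  · simpa using this
  · simp only [outDeg_graph]
    exact (prob_row (fun e : Fin n × Fin n => edgeProb wp wm e.1 e.2) x
      {r | rowDeg x r ≤ d}).le.trans
      (prob_rowDeg_le hp hm x hθ (h x))

lemma expect_rowDeg_le (hp : ∀ x, 0 ≤ wp x) (hm : ∀ x, 0 < wm x) (x : Fin n) :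
    expect (fun y => edgeProb wp wm x y) (rowDeg x) ≤ meanDeg wp wm x := by
  have h1 : expect (fun y => edgeProb wp wm x y) (rowDeg x)
      = ∑ y ∈ Finset.univ.erase x, edgeProb wp wm x y := by
    have := expect_sum (fun y => edgeProb wp wm x y) (Finset.univ.erase x)
      (fun y (r : Fin n → Bool) => if r y then 1 else 0)
    simp only [expect_coord] at this
    exact this
  rw [h1]
  calc ∑ y ∈ Finset.univ.erase x, edgeProb wp wm x y
      ≤ ∑ y, edgeProb wp wm x y :=
        Finset.sum_le_sum_of_subset_of_nonneg (Finset.subset_univ _)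
          fun y _ _ => (edgeProb_mem hp (fun z => (hm z).le) x y).1
    _ ≤ ∑ y, meanDeg wp wm x * muIn wm y :=
        Finset.sum_le_sum fun y _ => edgeProb_le_meanDeg_mul hm x y
    _ = meanDeg wp wm x := by rw [← Finset.mul_sum, sum_muIn hm (x.pos), mul_one]

/-! ### Bounds on the entropy -/

lemma entropy_eq (hp : ∀ x, 0 ≤ wp x) (hm : ∀ x, 0 < wm x) :
    entropy wp wm = ∑ x, muIn wm x *
      expect (fun y => edgeProb wp wm x y) (fun r => Real.log (max (rowDeg x r) 1)) := by
  unfold entropy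
  refine Finset.sum_congr rfl fun x _ => ?_
  rw [integral_law hp (fun z => (hm z).le)]
  simp only [outDeg_graph]
  rw [expect_row (fun e : Fin n × Fin n => edgeProb wp wm e.1 e.2) x
    (fun r => Real.log (max (rowDeg x r) 1))]

lemma entropy_le (hp : ∀ x, 0 ≤ wp x) (hm : ∀ x, 0 < wm x) (hn : 0 < n) {B κ : ℝ} (hκ : 0 < κ)
    (hB : ∀ x, meanDeg wp wm x ≤ B) : entropy wp wm ≤ κ * (1 + B) - Real.log κ := by
  rw [entropy_eq hp hm]
  calc _ ≤ ∑ x, muIn wm x * (κ * (1 + B) - Real.log κ) := by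
        refine Finset.sum_le_sum fun x _ => mul_le_mul_of_nonneg_left ?_ (muIn_nonneg hm x)
        have hpr : ∀ y, 0 ≤ edgeProb wp wm x y ∧ edgeProb wp wm x y ≤ 1 :=
          fun y => edgeProb_mem hp (fun z => (hm z).le) x y
        have hpt : ∀ r, Real.log (max (rowDeg x r) 1) ≤ (κ - Real.log κ) + κ * rowDeg x r := by
          intro r
          obtain ⟨k, hk⟩ := rowDeg_eq_natCast x r
          have h0 : (0 : ℝ) ≤ k := Nat.cast_nonneg k
          have h1 : (0 : ℝ) < max (k : ℝ) 1 := lt_max_of_lt_right one_pos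
          have h2 := Real.log_le_sub_one_of_pos (mul_pos hκ h1)
          rw [Real.log_mul hκ.ne' h1.ne'] at h2
          have h3 : max (k : ℝ) 1 ≤ 1 + k := max_le (by linarith) (by linarith)
          have h4 := mul_le_mul_of_nonneg_left h3 hκ.le
          rw [hk]
          linarith
        refine (expect_mono hpr hpt).trans ?_
        rw [expect_add, expect_const, expect_mul_left]
        have := mul_le_mul_of_nonneg_left ((expect_rowDeg_le hp hm x).trans (hB x)) hκ.le
        have h5 : expect (fun y => edgeProb wp wm x y) (fun r => rowDeg x r)
          = expect (fun y => edgeProb wp wm x y) (rowDeg x) := rfl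
        rw [h5]
        linarith
    _ = _ := by rw [← Finset.sum_mul, sum_muIn hm hn, one_mul]

lemma le_entropy (hp : ∀ x, 0 ≤ wp x) (hm : ∀ x, 0 < wm x) (hn : 0 < n) {d ρ : ℝ} (hd : 1 ≤ d)
    (hρ : ∀ x, prob (fun y => edgeProb wp wm x y) {r | rowDeg x r ≤ d} ≤ ρ) :
    Real.log d * (1 - ρ) ≤ entropy wp wm := by
  rw [entropy_eq hp hm]
  calc Real.log d * (1 - ρ) = ∑ x, muIn wm x * (Real.log d * (1 - ρ)) := by
        rw [← Finset.sum_mul, sum_muIn hm hn, one_mul]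
    _ ≤ _ := by
        refine Finset.sum_le_sum fun x _ => mul_le_mul_of_nonneg_left ?_ (muIn_nonneg hm x)
        have hpr : ∀ y, 0 ≤ edgeProb wp wm x y ∧ edgeProb wp wm x y ≤ 1 :=
          fun y => edgeProb_mem hp (fun z => (hm z).le) x y
        set S : Set (Fin n → Bool) := {r | rowDeg x r ≤ d} with hS
        have hld : 0 ≤ Real.log d := Real.log_nonneg hd
        have hpt : ∀ r, Real.log d + (-Real.log d) * S.indicator 1 r
            ≤ Real.log (max (rowDeg x r) 1) := by
          intro r
          by_cases hr : r ∈ S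
          · rw [Set.indicator_of_mem hr]
            have := Real.log_nonneg (le_max_right (rowDeg x r) 1)
            simpa using this
          · rw [Set.indicator_of_notMem hr, mul_zero, add_zero]
            have h1 : d < rowDeg x r := not_le.1 hr
            exact Real.log_le_log (by linarith) (h1.le.trans (le_max_left _ _))
        refine le_trans ?_ (expect_mono hpr hpt)
        rw [expect_add, expect_const, expect_mul_left]
        have h1 := mul_le_mul_of_nonneg_left (hρ x) hld
        have h2 : expect (fun y => edgeProb wp wm x y) (S.indicator 1)
          = prob (fun y => edgeProb wp wm x y) S := rfl
        have h3 : expect (fun y => edgeProb wp wm x y) (fun r => S.indicator 1 r)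
          = expect (fun y => edgeProb wp wm x y) (S.indicator 1) := rfl
        rw [h3, h2]
        linarith

end Degrees

/-! ### Growth of the in-neighbourhoods -/

section Growth

variable {n : ℕ} {wp wm : Fin n → ℝ}

lemma graph_adj {ω : Fin n × Fin n → Bool} {a b : Fin n} :
    (graph ω).Adj a b ↔ a ≠ b ∧ ω (a, b) = true := Iff.rfl

/-- Total in-weight of a set of vertices. -/
def inWeight (wm : Fin n → ℝ) (S : Finset (Fin n)) : ℝ := ∑ v ∈ S, wm v

lemma inWeight_nonneg (hm : ∀ x, 0 < wm x) (S : Finset (Fin n)) : 0 ≤ inWeight wm S :=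
  Finset.sum_nonneg fun v _ => (hm v).le

/-- The sphere of radius `k` around `y` is determined by the indicators of the edges that do not
point into it. -/
lemma sphere_eq_of_agree {ω ω' : Fin n × Fin n → Bool} {y : Fin n} {k : ℕ}
    (h : ∀ e ∉ (Finset.univ : Finset (Fin n)) ×ˢ sphere (graph ω) y k, ω' e = ω e) :
    sphere (graph ω') y k = sphere (graph ω) y k := by
  refine sphere_congr fun v hv z => ?_
  rw [graph_adj, graph_adj, h (z, v) (by simp [hv])]

/-- One step of the growth of the in-neighbourhood of `y`. -/
lemma prob_sphere_growth (hp : ∀ x, 0 ≤ wp x) (hm : ∀ x, 0 < wm x) {M₁ B L : ℝ}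
    (hM : ∀ x, wp x ≤ M₁) (hW : ∑ z, wm z ≤ M₁ * n) (hB0 : 0 < B) (hB : ∀ x, wm x ≤ B)
    (hL : L = Real.log n) (y : Fin n) (k : ℕ) :
    prob (fun e => edgeProb wp wm e.1 e.2) {ω | 2 * M₁ ^ 2 * L * inWeight wm (sphere (graph ω) y k)
        + B * L ^ 2 ≤ inWeight wm (sphere (graph ω) y (k + 1))} ≤ Real.exp (-L ^ 2) := by
  classical
  have hpr : ∀ e : Fin n × Fin n, 0 ≤ edgeProb wp wm e.1 e.2 ∧ edgeProb wp wm e.1 e.2 ≤ 1 :=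
    fun e => edgeProb_mem hp (fun z => (hm z).le) e.1 e.2
  have hn : (0 : ℝ) < n := by exact_mod_cast y.pos
  have hL0 : 0 ≤ L := hL ▸ Real.log_natCast_nonneg n
  have hM0 : 0 ≤ M₁ := (hp y).trans (hM y)
  refine le_trans (prob_mono hpr ?_) (prob_linear_unrevealed_ge_le hpr
    (fun ω => (Finset.univ : Finset (Fin n)) ×ˢ sphere (graph ω) y k)
    (fun ω ω' h => by rw [sphere_eq_of_agree h])
    (fun _ e => wm e.1 / B) (fun _ _ _ _ _ => rfl)
    (fun ω => 2 * M₁ ^ 2 * L * inWeight wm (sphere (graph ω) y k) / B + L ^ 2)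
    (fun ω ω' h => by simp only [sphere_eq_of_agree h]) (L ^ 2) ?_)
  · intro ω hω
    rw [Set.mem_ofPred_eq] at hω ⊢
    have h1 : inWeight wm (sphere (graph ω) y (k + 1)) / B
        ≤ ∑ e ∈ (Finset.univ : Finset (Fin n)) ×ˢ sphere (graph ω) y k,
          if ω e then wm e.1 / B else 0 := by
      rw [inWeight, Finset.sum_div, Finset.sum_product]
      have h0 : ∀ z v, 0 ≤ if ω (z, v) then wm z / B else 0 := by
        intro z v
        have := (hm z).le
        split_ifs <;> positivity
      refine (Finset.sum_le_sum (g := fun z => ∑ v ∈ sphere (graph ω) y k,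
        if ω (z, v) then wm z / B else 0) fun z hz => ?_).trans
        (Finset.sum_le_sum_of_subset_of_nonneg (Finset.subset_univ _)
          fun z _ _ => Finset.sum_nonneg fun v _ => h0 z v)
      obtain ⟨v, hv, hzv⟩ := exists_adj_of_mem_sphere_succ hz
      refine le_trans ?_ (Finset.single_le_sum (fun v _ => h0 z v) hv)
      rw [if_pos hzv.2]
    refine le_trans ?_ h1
    rw [le_div_iff₀ hB0, add_mul, div_mul_cancel₀ _ hB0.ne']
    linarith
  · intro ω
    set S := sphere (graph ω) y k
    have hterm : ∀ e ∈ (Finset.univ : Finset (Fin n)) ×ˢ S,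
        edgeProb wp wm e.1 e.2 * (Real.exp (wm e.1 / B) - 1)
          ≤ (2 * M₁ * (L / n) / B) * (wm e.1 * wm e.2) := by
      intro e _
      have h1 : wm e.1 / B ≤ 1 := (div_le_one hB0).2 (hB _)
      have h2 : 0 ≤ wm e.1 / B := div_nonneg (hm _).le hB0.le
      have h3 : Real.exp (wm e.1 / B) - 1 ≤ 2 * (wm e.1 / B) := by
        have := exp_sub_one_le_mul h2 h1 h1
        linarith
      have h4 : 0 ≤ Real.exp (wm e.1 / B) - 1 := by linarith [Real.add_one_le_exp (wm e.1 / B)]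
      have h5 : edgeProb wp wm e.1 e.2 ≤ M₁ * wm e.2 * (L / n) := by
        refine (edgeProb_le e.1 e.2).trans ?_
        rw [← hL]
        have := hM e.1
        have := (hm e.2).le
        gcongr
      calc _ ≤ (M₁ * wm e.2 * (L / n)) * (2 * (wm e.1 / B)) :=
            mul_le_mul h5 h3 h4 ((hpr e).1.trans h5)
        _ = _ := by ring
    refine (Finset.sum_le_sum hterm).trans ?_
    rw [← Finset.mul_sum, Finset.sum_product, ← Finset.sum_mul_sum, add_sub_cancel_right]
    calc 2 * M₁ * (L / n) / B * ((∑ z, wm z) * ∑ v ∈ S, wm v)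
        ≤ 2 * M₁ * (L / n) / B * ((M₁ * n) * ∑ v ∈ S, wm v) := by
          have := inWeight_nonneg hm S
          rw [inWeight] at this
          gcongr
      _ = 2 * M₁ ^ 2 * L * inWeight wm S / B := by
          rw [inWeight]
          field_simp

/-- Bound on the in-weight of the spheres when every growth step behaves. -/
lemma inWeight_sphere_le {G : Digraph (Fin n)} {y : Fin n} {A B L : ℝ} (hL : 1 ≤ L) (hA : 1 ≤ A)
    (hB0 : 0 ≤ B) (hB : wm y ≤ B) {h : ℕ}
    (hg : ∀ k < h, inWeight wm (sphere G y (k + 1)) ≤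
      A * inWeight wm (sphere G y k) + B * L ^ 2) (k : ℕ) (hk : k ≤ h) :
    inWeight wm (sphere G y k) ≤ B * L ^ 2 * (2 * A) ^ k := by
  have hL2 : 1 ≤ L ^ 2 := one_le_pow₀ hL
  induction k with
  | zero =>
    have h1 : sphere G y 0 = {y} := by simp [sphere, near]
    rw [h1, inWeight, Finset.sum_singleton, pow_zero, mul_one]
    nlinarith
  | succ k ih =>
    have h1 := ih (by omega)
    have h2 : 1 ≤ (2 * A) ^ k := one_le_pow₀ (by linarith)
    have h3 : 0 ≤ B * L ^ 2 := by positivity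
    calc _ ≤ A * inWeight wm (sphere G y k) + B * L ^ 2 := hg k (by omega)
      _ ≤ A * (B * L ^ 2 * (2 * A) ^ k) + B * L ^ 2 * (A * (2 * A) ^ k) := by
          refine add_le_add (mul_le_mul_of_nonneg_left h1 (by linarith)) ?_
          exact le_mul_of_one_le_right h3 (one_le_mul_of_one_le_of_one_le hA h2)
      _ = _ := by ring

open scoped Classical in
/-- A vertex has few edges into a sphere of small in-weight. -/
lemma prob_card_adj_sphere_ge (hp : ∀ x, 0 ≤ wp x) (hm : ∀ x, 0 < wm x) {M₁ Y κ K : ℝ}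
    (hM : ∀ x, wp x ≤ M₁) (hκ : 0 < κ) (hY : Real.exp κ * (M₁ * (Real.log n / n) * Y) ≤ 1)
    (y z : Fin n) (k : ℕ) :
    prob (fun e => edgeProb wp wm e.1 e.2) {ω | inWeight wm (sphere (graph ω) y k) ≤ Y ∧
        K ≤ (((sphere (graph ω) y k).filter fun v => (graph ω).Adj z v).card : ℝ)}
      ≤ Real.exp (-(κ * K - 1)) := by
  have hpr : ∀ e : Fin n × Fin n, 0 ≤ edgeProb wp wm e.1 e.2 ∧ edgeProb wp wm e.1 e.2 ≤ 1 :=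
    fun e => edgeProb_mem hp (fun z => (hm z).le) e.1 e.2
  have hM0 : 0 ≤ M₁ := (hp y).trans (hM y)
  refine le_trans (prob_mono hpr ?_) (prob_linear_unrevealed_ge_le hpr
    (fun ω => (Finset.univ : Finset (Fin n)) ×ˢ sphere (graph ω) y k)
    (fun ω ω' h => by rw [sphere_eq_of_agree h])
    (fun ω e => if inWeight wm (sphere (graph ω) y k) ≤ Y ∧ e.1 = z then κ else 0)
    (fun ω ω' h _ _ => by simp only [sphere_eq_of_agree h])
    (fun _ => κ * K) (fun _ _ _ => rfl) (κ * K - 1) ?_)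
  · rintro ω ⟨h1, h2⟩
    rw [Set.mem_ofPred_eq, Finset.sum_product]
    simp only [h1, true_and]
    have h0 : ∀ a v, 0 ≤ if ω (a, v) then (if a = z then κ else 0) else 0 := by
      intro a v
      split_ifs <;> simp [hκ.le]
    refine le_trans ?_ (Finset.single_le_sum (f := fun a => ∑ v ∈ sphere (graph ω) y k,
      if ω (a, v) then (if a = z then κ else 0) else 0)
      (fun a _ => Finset.sum_nonneg fun v _ => h0 a v) (Finset.mem_univ z))
    simp only [if_true]
    calc κ * K ≤ κ * (((sphere (graph ω) y k).filter fun v => (graph ω).Adj z v).card : ℝ) := by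
          gcongr
      _ = ∑ v ∈ (sphere (graph ω) y k).filter fun v => (graph ω).Adj z v, κ := by
          rw [Finset.sum_const, nsmul_eq_mul, mul_comm]
      _ = ∑ v ∈ sphere (graph ω) y k, if (graph ω).Adj z v then κ else 0 := Finset.sum_filter _ _
      _ ≤ _ := by
          refine Finset.sum_le_sum fun v _ => ?_
          by_cases hadj : (graph ω).Adj z v
          · rw [if_pos hadj, if_pos hadj.2]
          · rw [if_neg hadj]
            have := h0 z v
            simpa using this
  · intro ω
    rw [sub_sub_cancel]
    set S := sphere (graph ω) y k
    by_cases hS : inWeight wm S ≤ Y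
    · rw [Finset.sum_product, Finset.sum_eq_single z]
      · simp only [hS, and_self, if_true]
        calc ∑ v ∈ S, edgeProb wp wm z v * (Real.exp κ - 1)
            ≤ ∑ v ∈ S, (M₁ * wm v * (Real.log n / n)) * Real.exp κ := by
              refine Finset.sum_le_sum fun v _ => ?_
              have h1 : edgeProb wp wm z v ≤ M₁ * wm v * (Real.log n / n) := by
                refine (edgeProb_le z v).trans ?_
                have := hM z
                have := (hm v).le
                have := log_div_nonneg n
                gcongr
              exact mul_le_mul h1 (by linarith) (by linarith [Real.add_one_le_exp κ])
                ((hpr (z, v)).1.trans h1)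
          _ = Real.exp κ * (M₁ * (Real.log n / n) * inWeight wm S) := by
              rw [inWeight, Finset.mul_sum, Finset.mul_sum]
              exact Finset.sum_congr rfl fun v _ => by ring
          _ ≤ Real.exp κ * (M₁ * (Real.log n / n) * Y) := by
              have := log_div_nonneg n
              gcongr
          _ ≤ 1 := hY
      · intro a _ ha
        simp [ha]
      · simp
    · simp [hS]

end Growth

/-! ### Concentration of the weight of the tree and of the crossing edges -/

section Concentration

variable {n : ℕ} {wp wm : Fin n → ℝ} {s h : ℕ} {θ : ℝ}
  {tie : Finset (Fin n × Fin n) → Fin n × Fin n}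

/-- The ratios between the mean and the actual out-degrees of the vertices at depth `s` average to
about `1` under the masses of these vertices, because their rows are fresh. The masses are
truncated at `β`. -/
lemma prob_sum_inv_deg_ge (hp : ∀ x, 0 ≤ wp x) (hm : ∀ x, 0 < wm x) {B β δ : ℝ} (hB0 : 0 < B)
    (hβ : 0 < β) (hB : ∀ x, meanDeg wp wm x ≤ B) (hδ0 : 0 < δ) (hδ1 : δ ≤ 1)
    (hexp : ∀ x, expect (fun y => edgeProb wp wm x y)
      (fun r => meanDeg wp wm x / rowDeg x r) ≤ 1 + δ)
    (htie : ∀ S, S.Nonempty → tie S ∈ S) (x : Fin n) :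
    prob (fun e => edgeProb wp wm e.1 e.2) {ω | (1 + δ) ^ 2 + δ ≤
        ∑ u ∈ bottom (graph ω) s θ tie x, min (treeMass (graph ω) s θ tie x u) β *
          (meanDeg wp wm u / outDeg (graph ω) u)} ≤ Real.exp (-(δ ^ 2 / (β * B))) := by
  have hpr : ∀ e : Fin n × Fin n, 0 ≤ edgeProb wp wm e.1 e.2 ∧ edgeProb wp wm e.1 e.2 ≤ 1 :=
    fun e => edgeProb_mem hp (fun z => (hm z).le) e.1 e.2
  set κ := δ / (β * B) with hκ
  have hκ0 : 0 < κ := by positivity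
  have hrow : ∀ ω ω' : Fin n × Fin n → Bool,
      (∀ a b, a ∉ bottom (graph ω) s θ tie x → ω' (a, b) = ω (a, b)) →
      ∀ v ∉ bottom (graph ω) s θ tie x, SameRow (graph ω) (graph ω') v := by
    intro ω ω' h v hv b
    rw [graph_adj, graph_adj, h v b hv]
  have hℓ : δ ^ 2 / (β * B) = κ * δ := by rw [hκ]; ring
  rw [hℓ]
  refine le_trans (prob_mono hpr ?_) (prob_rows_unrevealed_ge_le hpr
    (fun ω => bottom (graph ω) s θ tie x)
    (fun ω ω' h => bottom_congr htie (hrow ω ω' h))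
    (fun ω u => κ * min (treeMass (graph ω) s θ tie x u) β)
    (fun ω ω' h u hu => by rw [treeMass_congr htie (hrow ω ω' h) hu])
    (fun u r => meanDeg wp wm u / rowDeg u r) (κ * ((1 + δ) ^ 2 + δ)) (κ * δ) ?_)
  · intro ω hω
    rw [Set.mem_ofPred_eq] at hω ⊢
    simp only [outDeg_graph] at hω
    simp only [mul_assoc, ← Finset.mul_sum]
    exact mul_le_mul_of_nonneg_left hω hκ0.le
  · intro ω
    set m : Fin n → ℝ := fun u => min (treeMass (graph ω) s θ tie x u) β with hm_def
    have hm0 : ∀ u, 0 ≤ m u := fun u => le_min (treeMass_nonneg u) hβ.le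
    have hmβ : ∀ u, m u ≤ β := fun u => min_le_right _ _
    have hterm : ∀ u, expect (fun y => edgeProb wp wm u y)
        (fun r => Real.exp (κ * m u * (meanDeg wp wm u / rowDeg u r)))
        ≤ Real.exp (κ * (1 + δ) ^ 2 * m u) := by
      intro u
      have hpu : ∀ y, 0 ≤ edgeProb wp wm u y ∧ edgeProb wp wm u y ≤ 1 := fun y => hpr (u, y)
      have hl := meanDeg_nonneg hp hm u
      have hpt : ∀ r, Real.exp (κ * m u * (meanDeg wp wm u / rowDeg u r))
          ≤ 1 + ((1 + δ) * (κ * m u)) * (meanDeg wp wm u / rowDeg u r) := by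
        intro r
        obtain ⟨k, hk⟩ := rowDeg_eq_natCast u r
        have h0 : 0 ≤ meanDeg wp wm u / rowDeg u r := by rw [hk]; positivity
        have h1 : meanDeg wp wm u / rowDeg u r ≤ B := by
          rw [hk]
          rcases Nat.eq_zero_or_pos k with rfl | hk0
          · simpa using hB0.le
          · exact (div_le_self hl (by exact_mod_cast hk0)).trans (hB u)
        have hmu := hm0 u
        have h2 : κ * m u * (meanDeg wp wm u / rowDeg u r) ≤ δ := by
          calc κ * m u * (meanDeg wp wm u / rowDeg u r) ≤ κ * β * B := by
                have := hmβ u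
                gcongr
            _ = δ := by rw [hκ]; field_simp
        have := exp_sub_one_le_mul (by positivity) h2 (h2.trans hδ1)
        linarith
      refine (expect_mono hpu hpt).trans ?_
      rw [expect_add, expect_const, expect_mul_left]
      have hmu := hm0 u
      have h3 : (1 + δ) * (κ * m u) * expect (fun y => edgeProb wp wm u y)
          (fun r => meanDeg wp wm u / rowDeg u r) ≤ (1 + δ) * (κ * m u) * (1 + δ) :=
        mul_le_mul_of_nonneg_left (hexp u) (by positivity)
      have h4 := Real.add_one_le_exp (κ * (1 + δ) ^ 2 * m u)
      linarith
    have hnn : ∀ u, 0 ≤ expect (fun y => edgeProb wp wm u y)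
        (fun r => Real.exp (κ * m u * (meanDeg wp wm u / rowDeg u r))) := fun u =>
      expect_nonneg (fun y => hpr (u, y)) fun r => (Real.exp_pos _).le
    calc _ ≤ ∏ u ∈ bottom (graph ω) s θ tie x, Real.exp (κ * (1 + δ) ^ 2 * m u) :=
          Finset.prod_le_prod (fun u _ => hnn u) fun u _ => hterm u
      _ = Real.exp (κ * (1 + δ) ^ 2 * ∑ u ∈ bottom (graph ω) s θ tie x, m u) := by
          rw [← Real.exp_sum, Finset.mul_sum]
      _ ≤ Real.exp (κ * ((1 + δ) ^ 2 + δ) - κ * δ) := by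
          refine Real.exp_le_exp.2 ?_
          have h1 : ∑ u ∈ bottom (graph ω) s θ tie x, m u ≤ 1 :=
            (Finset.sum_le_sum fun u _ => min_le_left _ _).trans (sum_treeMass_le htie)
          have h2 : 0 ≤ κ * (1 + δ) ^ 2 := by positivity
          nlinarith

/-- The average `∑ m(u) E[D_u] / D_u` over the vertices `u` at depth `s` of the tree of `x`, when
the edges into the sphere of radius `h` around `y` are disregarded in the out-degree. -/
def cutRatio (wp wm : Fin n → ℝ) (G : Digraph (Fin n)) (s h : ℕ) (θ : ℝ)
    (tie : Finset (Fin n × Fin n) → Fin n × Fin n) (x y : Fin n) : ℝ :=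
  ∑ u ∈ bottom G s θ tie x,
    treeMass G s θ tie x u * (meanDeg wp wm u / outDeg (cut G (sphere G y h)) u)

lemma piTilde_nonneg (hm : ∀ x, 0 < wm x) (G : Digraph (Fin n)) (h : ℕ) (y : Fin n) :
    0 ≤ piTilde wm G h y := by
  unfold piTilde Matrix.vecMul dotProduct
  exact Finset.sum_nonneg fun v _ => mul_nonneg (muIn_nonneg hm v) (walk_pow_nonneg G h v y)

lemma sum_mean_crossWeight_le (hm : ∀ x, 0 < wm x) (hp : ∀ x, 0 ≤ wp x) (G : Digraph (Fin n))
    (x y : Fin n) :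
    ∑ e ∈ bottom G s θ tie x ×ˢ sphere G y h,
      edgeProb wp wm e.1 e.2 * crossWeight G s h θ tie x y e.1 e.2
      ≤ cutRatio wp wm G s h θ tie x y * piTilde wm (cut G (sphere G y h)) h y := by
  set S := sphere G y h with hS
  rw [Finset.sum_product]
  have h1 : ∀ v, 0 ≤ muIn wm v * (walk (cut G S) ^ h) v y := fun v =>
    mul_nonneg (muIn_nonneg hm v) (walk_pow_nonneg _ _ _ _)
  have hpi : ∑ v ∈ S, muIn wm v * (walk (cut G S) ^ h) v y ≤ piTilde wm (cut G S) h y :=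
    Finset.sum_le_sum_of_subset_of_nonneg (Finset.subset_univ _) fun v _ _ => h1 v
  rw [cutRatio, Finset.sum_mul]
  refine Finset.sum_le_sum fun u _ => ?_
  have hT := treeMass_nonneg (G := G) (s := s) (θ := θ) (tie := tie) (x := x) u
  have hl := meanDeg_nonneg hp hm u
  calc ∑ v ∈ S, edgeProb wp wm u v * crossWeight G s h θ tie x y u v
      ≤ ∑ v ∈ S, (meanDeg wp wm u * muIn wm v) * crossWeight G s h θ tie x y u v :=
        Finset.sum_le_sum fun v _ => mul_le_mul_of_nonneg_right (edgeProb_le_meanDeg_mul hm u v)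
          (crossWeight_nonneg y u v)
    _ = (treeMass G s θ tie x u * (meanDeg wp wm u / outDeg (cut G S) u)) *
          ∑ v ∈ S, muIn wm v * (walk (cut G S) ^ h) v y := by
        rw [Finset.mul_sum]
        refine Finset.sum_congr rfl fun v _ => ?_
        rw [crossWeight]
        ring
    _ ≤ _ := mul_le_mul_of_nonneg_left hpi (by positivity)

/-- Concentration of the weight of the edges that lead from the bottom of the tree of `x` to the
sphere around `y`. None of these edges is seen by the tree, by the sphere or by the weights. -/
lemma prob_crossing_ge (hp : ∀ x, 0 ≤ wp x) (hm : ∀ x, 0 < wm x) {b δ τ : ℝ} (hb : 0 < b)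
    (hδ0 : 0 < δ) (hδ1 : δ ≤ 1) (htie : ∀ S, S.Nonempty → tie S ∈ S) (x y : Fin n) :
    prob (fun e => edgeProb wp wm e.1 e.2) {ω | (1 + δ) * (cutRatio wp wm (graph ω) s h θ tie x y *
        piTilde wm (cut (graph ω) (sphere (graph ω) y h)) h y) + τ ≤
        ∑ e ∈ bottom (graph ω) s θ tie x ×ˢ sphere (graph ω) y h,
          if ω e then truncWeight (graph ω) s h θ tie x y b e.1 e.2 else 0}
      ≤ Real.exp (-(δ / b * τ)) := by
  have hpr : ∀ e : Fin n × Fin n, 0 ≤ edgeProb wp wm e.1 e.2 ∧ edgeProb wp wm e.1 e.2 ≤ 1 :=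
    fun e => edgeProb_mem hp (fun z => (hm z).le) e.1 e.2
  set A : (Fin n × Fin n → Bool) → Finset (Fin n × Fin n) := fun ω =>
    bottom (graph ω) s θ tie x ×ˢ sphere (graph ω) y h with hA
  have hrow : ∀ ω ω' : Fin n × Fin n → Bool, (∀ e ∉ A ω, ω' e = ω e) →
      ∀ v ∉ bottom (graph ω) s θ tie x, SameRow (graph ω) (graph ω') v := by
    intro ω ω' hag v hv b
    rw [graph_adj, graph_adj, hag (v, b) (by simp [hA, hv])]
  have hsph : ∀ ω ω' : Fin n × Fin n → Bool, (∀ e ∉ A ω, ω' e = ω e) →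
      sphere (graph ω') y h = sphere (graph ω) y h := by
    intro ω ω' hag
    refine sphere_eq_of_agree fun e he => hag e fun he' => he ?_
    simp only [hA, Finset.mem_product] at he'
    simp [he'.2]
  have hbot : ∀ ω ω' : Fin n × Fin n → Bool, (∀ e ∉ A ω, ω' e = ω e) →
      bottom (graph ω') s θ tie x = bottom (graph ω) s θ tie x :=
    fun ω ω' hag => bottom_congr htie (hrow ω ω' hag)
  have hcut : ∀ ω ω' : Fin n × Fin n → Bool, (∀ e ∉ A ω, ω' e = ω e) →
      cut (graph ω') (sphere (graph ω) y h) = cut (graph ω) (sphere (graph ω) y h) := by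
    intro ω ω' hag
    ext a b
    refine and_congr_left fun hb => ?_
    rw [graph_adj, graph_adj, hag (a, b) (by simp [hA, hb])]
  have hcross : ∀ ω ω' : Fin n × Fin n → Bool, (∀ e ∉ A ω, ω' e = ω e) → ∀ e ∈ A ω,
      truncWeight (graph ω') s h θ tie x y b e.1 e.2
        = truncWeight (graph ω) s h θ tie x y b e.1 e.2 := by
    intro ω ω' hag e he
    rw [truncWeight, truncWeight, crossWeight, crossWeight, hsph ω ω' hag, hcut ω ω' hag,
      treeMass_congr htie (hrow ω ω' hag) (Finset.mem_product.1 he).1]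
  have hratio : ∀ ω ω' : Fin n × Fin n → Bool, (∀ e ∉ A ω, ω' e = ω e) →
      cutRatio wp wm (graph ω') s h θ tie x y = cutRatio wp wm (graph ω) s h θ tie x y := by
    intro ω ω' hag
    rw [cutRatio, cutRatio, hbot ω ω' hag, hsph ω ω' hag, hcut ω ω' hag]
    exact Finset.sum_congr rfl fun u hu => by rw [treeMass_congr htie (hrow ω ω' hag) hu]
  refine le_trans (prob_mono hpr ?_) (prob_linear_unrevealed_ge_le hpr A
    (fun ω ω' hag => by simp only [hA]; rw [hbot ω ω' hag, hsph ω ω' hag])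
    (fun ω e => δ / b * truncWeight (graph ω) s h θ tie x y b e.1 e.2)
    (fun ω ω' hag e he => by rw [hcross ω ω' hag e he])
    (fun ω => δ / b * ((1 + δ) * (cutRatio wp wm (graph ω) s h θ tie x y *
      piTilde wm (cut (graph ω) (sphere (graph ω) y h)) h y) + τ))
    (fun ω ω' hag => by rw [hratio ω ω' hag, hsph ω ω' hag, hcut ω ω' hag]) (δ / b * τ) ?_)
  · intro ω hω
    rw [Set.mem_ofPred_eq] at hω ⊢
    refine (mul_le_mul_of_nonneg_left hω (by positivity : 0 ≤ δ / b)).trans (le_of_eq ?_)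
    rw [Finset.mul_sum]
    exact Finset.sum_congr rfl fun e _ => by rw [mul_ite, mul_zero]
  · intro ω
    have hterm : ∀ e ∈ A ω, edgeProb wp wm e.1 e.2 *
        (Real.exp (δ / b * truncWeight (graph ω) s h θ tie x y b e.1 e.2) - 1)
        ≤ ((1 + δ) * (δ / b)) *
          (edgeProb wp wm e.1 e.2 * crossWeight (graph ω) s h θ tie x y e.1 e.2) := by
      intro e _
      set w := truncWeight (graph ω) s h θ tie x y b e.1 e.2 with hw
      have hw0 : 0 ≤ w := truncWeight_nonneg _ _ _ _
      have hwb : w ≤ b := truncWeight_le hb.le _ _ _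
      have h1 : δ / b * w ≤ δ := by
        calc δ / b * w ≤ δ / b * b := by gcongr
          _ = δ := by field_simp
      have h2 := exp_sub_one_le_mul (by positivity) h1 (h1.trans hδ1)
      have h3 : w ≤ crossWeight (graph ω) s h θ tie x y e.1 e.2 :=
        truncWeight_le_crossWeight _ _ _ _
      have he := (hpr e).1
      calc _ ≤ edgeProb wp wm e.1 e.2 * ((1 + δ) * (δ / b * w)) := by gcongr
        _ ≤ edgeProb wp wm e.1 e.2 *
            ((1 + δ) * (δ / b * crossWeight (graph ω) s h θ tie x y e.1 e.2)) := by gcongr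
        _ = _ := by ring
    refine (Finset.sum_le_sum hterm).trans ?_
    rw [← Finset.mul_sum]
    have := mul_le_mul_of_nonneg_left (sum_mean_crossWeight_le (s := s) (h := h) (θ := θ)
      (tie := tie) hm hp (graph ω) x y) (by positivity : 0 ≤ (1 + δ) * (δ / b))
    linarith

end Concentration

/-! ### The bound for a fixed number of vertices -/

section FixedSize

variable {n : ℕ} {wp wm : Fin n → ℝ}

lemma piTilde_cut_le (hm : ∀ x, 0 < wm x) {G : Digraph (Fin n)} {S : Finset (Fin n)} {r : ℝ}
    (hr0 : 0 ≤ r) (hr : ∀ a, (outDeg G a : ℝ) ≤ r * outDeg (cut G S) a) (h : ℕ) (y : Fin n) :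
    piTilde wm (cut G S) h y ≤ r ^ h * piTilde wm G h y := by
  unfold piTilde Matrix.vecMul dotProduct
  rw [Finset.mul_sum]
  refine Finset.sum_le_sum fun v _ => ?_
  calc muIn wm v * (walk (cut G S) ^ h) v y ≤ muIn wm v * (r ^ h * (walk G ^ h) v y) :=
        mul_le_mul_of_nonneg_left (walk_cut_pow_le hr0 hr h v y) (muIn_nonneg hm v)
    _ = _ := by ring

lemma cutRatio_le (hp : ∀ x, 0 ≤ wp x) (hm : ∀ x, 0 < wm x) {G : Digraph (Fin n)} {s h : ℕ}
    {θ r d β : ℝ} {tie : Finset (Fin n × Fin n) → Fin n × Fin n}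
    (htie : ∀ S, S.Nonempty → tie S ∈ S) {x y : Fin n} (hd : 0 < d)
    (hdeg : ∀ a, d ≤ outDeg G a) (hβ : (1 / d) ^ s ≤ β) (hr0 : 0 ≤ r)
    (hr : ∀ a, (outDeg G a : ℝ) ≤ r * outDeg (cut G (sphere G y h)) a) :
    cutRatio wp wm G s h θ tie x y ≤ r * ∑ u ∈ bottom G s θ tie x,
      min (treeMass G s θ tie x u) β * (meanDeg wp wm u / outDeg G u) := by
  rw [cutRatio, Finset.mul_sum]
  refine Finset.sum_le_sum fun u hu => ?_
  have hl := meanDeg_nonneg hp hm u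
  have hT := treeMass_nonneg (G := G) (s := s) (θ := θ) (tie := tie) (x := x) u
  have hmin : min (treeMass G s θ tie x u) β = treeMass G s θ tie x u :=
    min_eq_left (((isPath_of_mem_bottom htie hu).mass_le_pow hd hdeg).trans hβ)
  have hD : (0 : ℝ) < outDeg G u := hd.trans_le (hdeg u)
  have hDr := hr u
  have hD' : (0 : ℝ) < outDeg (cut G (sphere G y h)) u := by
    by_contra hneg
    have := mul_nonpos_of_nonneg_of_nonpos hr0 (not_lt.1 hneg)
    linarith
  rw [hmin]
  have key : meanDeg wp wm u / (outDeg (cut G (sphere G y h)) u : ℝ)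
      ≤ r * (meanDeg wp wm u / outDeg G u) := by
    rw [← mul_div_assoc, div_le_div_iff₀ hD' hD]
    calc meanDeg wp wm u * (outDeg G u : ℝ)
        ≤ meanDeg wp wm u * (r * outDeg (cut G (sphere G y h)) u) := by gcongr
      _ = _ := by ring
  calc _ ≤ treeMass G s θ tie x u * (r * (meanDeg wp wm u / outDeg G u)) :=
        mul_le_mul_of_nonneg_left key hT
    _ = _ := by ring

open scoped Classical in
/-- If every vertex has out-degree at least `d` and fewer than `K` edges into `S`, then removing
the edges into `S` changes the out-degrees by a factor at most `r`. -/
lemma outDeg_le_mul_outDeg_cut {G : Digraph (Fin n)} {S : Finset (Fin n)} {r d K : ℝ}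
    (hr : 1 ≤ r) (hrd : r * K ≤ (r - 1) * d) {a : Fin n} (hdeg : d ≤ outDeg G a)
    (hK : ((S.filter fun b => G.Adj a b).card : ℝ) ≤ K) :
    (outDeg G a : ℝ) ≤ r * outDeg (cut G S) a := by
  have h1 : (outDeg G a : ℝ) ≤ outDeg (cut G S) a + ((S.filter fun b => G.Adj a b).card : ℝ) := by
    exact_mod_cast outDeg_le_outDeg_cut_add G S a
  have h2 : (r - 1) * d ≤ (r - 1) * outDeg G a :=
    mul_le_mul_of_nonneg_left hdeg (by linarith)
  have h3 : r * (outDeg G a : ℝ) ≤ r * (outDeg (cut G S) a + K) :=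
    mul_le_mul_of_nonneg_left (by linarith) (by linarith)
  linarith

/-- Quantitative form of the theorem for a fixed `n`. Out-degrees are at least `d`, the spheres
have in-weight at most `Y`, and a vertex has fewer than `K` edges into a sphere, outside events
whose probabilities add up to the right-hand side. -/
lemma prob_goodEvent_compl_le {ε C δ δ' M₁ B Y κ K r d β ρ : ℝ} {s h : ℕ} {θ : ℝ}
    {tie : Fin n → Finset (Fin n × Fin n) → Fin n × Fin n}
    (htie : ∀ x S, S.Nonempty → tie x S ∈ S)
    (hs : s = sSteps wp wm (ε / 80)) (hh : h = hSteps wp wm ε)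
    (hθ : θ = Real.exp (-((1 + ε / 80) * entropy wp wm * sSteps wp wm (ε / 80))))
    (hp : ∀ x, 0 ≤ wp x) (hm : ∀ x, 0 < wm x) (hn : 0 < n) (hL : 1 ≤ Real.log n)
    (hM1 : 1 ≤ M₁) (hM : ∀ x, wp x ≤ M₁) (hW : ∑ z, wm z ≤ M₁ * n)
    (hB0 : 0 < B) (hB : ∀ x, wm x ≤ B)
    (hd : 0 < d)
    (hdeg : prob (fun e => edgeProb wp wm e.1 e.2)
      (⋃ x, {ω | (outDeg (graph ω) x : ℝ) ≤ d}) ≤ ρ)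
    (hYB : B * Real.log n ^ 2 * (2 * (2 * M₁ ^ 2 * Real.log n)) ^ h ≤ Y)
    (hκ : 0 < κ) (hY : Real.exp κ * (M₁ * (Real.log n / n) * Y) ≤ 1)
    (hr : 1 ≤ r) (hrd : r * K ≤ (r - 1) * d) (hrh : r ^ (h + 1) ≤ 1 + δ')
    (hβ0 : 0 < β) (hβ : (1 / d) ^ s ≤ β)
    (hmean : ∀ x, meanDeg wp wm x ≤ M₁ ^ 2 * Real.log n)
    (hδ'0 : 0 < δ') (hδ'1 : δ' ≤ 1)
    (hexp : ∀ x, expect (fun y => edgeProb wp wm x y)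
      (fun r => meanDeg wp wm x / rowDeg x r) ≤ 1 + δ')
    (hδδ' : (1 + δ') ^ 2 * ((1 + δ') ^ 2 + δ') ≤ 1 + δ) :
    prob (fun e => edgeProb wp wm e.1 e.2) (goodEvent wp wm ε C δ tie)ᶜ ≤
      ρ + n * h * Real.exp (-Real.log n ^ 2) + n * n * Real.exp (-(κ * K - 1))
        + n * Real.exp (-(δ' ^ 2 / (β * (M₁ ^ 2 * Real.log n))))
        + n * n * Real.exp (-(δ' / (2 / (n * Real.log n ^ 3)) * (δ / n))) := by
  classical
  have hpr : ∀ e : Fin n × Fin n, 0 ≤ edgeProb wp wm e.1 e.2 ∧ edgeProb wp wm e.1 e.2 ≤ 1 :=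
    fun e => edgeProb_mem hp (fun z => (hm z).le) e.1 e.2
  set L := Real.log n with hLdef
  have hn' : (0 : ℝ) < n := by exact_mod_cast hn
  set b : ℝ := 2 / (n * L ^ 3) with hb
  have hb0 : 0 < b := by positivity
  set E1 : Set (Fin n × Fin n → Bool) := ⋃ x, {ω | (outDeg (graph ω) x : ℝ) ≤ d} with hE1
  set E2 : Fin n × Fin h → Set (Fin n × Fin n → Bool) := fun i =>
    {ω | 2 * M₁ ^ 2 * L * inWeight wm (sphere (graph ω) i.1 i.2)
        + B * L ^ 2 ≤ inWeight wm (sphere (graph ω) i.1 (i.2 + 1))} with hE2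
  set E3 : Fin n × Fin n → Set (Fin n × Fin n → Bool) := fun i =>
    {ω | inWeight wm (sphere (graph ω) i.1 h) ≤ Y ∧
        K ≤ (((sphere (graph ω) i.1 h).filter fun v => (graph ω).Adj i.2 v).card : ℝ)} with hE3
  set E4 : Fin n → Set (Fin n × Fin n → Bool) := fun x => {ω | (1 + δ') ^ 2 + δ' ≤
        ∑ u ∈ bottom (graph ω) s θ (tie x) x, min (treeMass (graph ω) s θ (tie x) x u) β *
          (meanDeg wp wm u / outDeg (graph ω) u)} with hE4
  set E5 : Fin n × Fin n → Set (Fin n × Fin n → Bool) := fun i =>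
    {ω | (1 + δ') * (cutRatio wp wm (graph ω) s h θ (tie i.1) i.1 i.2 *
        piTilde wm (cut (graph ω) (sphere (graph ω) i.2 h)) h i.2) + δ / n ≤
        ∑ e ∈ bottom (graph ω) s θ (tie i.1) i.1 ×ˢ sphere (graph ω) i.2 h,
          if ω e then truncWeight (graph ω) s h θ (tie i.1) i.1 i.2 b e.1 e.2 else 0} with hE5
  have hcover : (goodEvent wp wm ε C δ tie)ᶜ ⊆
      (((E1 ∪ ⋃ i, E2 i) ∪ ⋃ i, E3 i) ∪ ⋃ i, E4 i) ∪ ⋃ i, E5 i := by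
    intro ω hω
    by_contra hnot
    simp only [Set.mem_union, Set.mem_iUnion, not_or, not_exists] at hnot
    obtain ⟨⟨⟨⟨h1, h2⟩, h3⟩, h4⟩, h5⟩ := hnot
    refine hω ?_
    intro x y _
    rw [← hθ, ← hs, ← hh]
    have hdeg' : ∀ a, d ≤ outDeg (graph ω) a := by
      intro a
      by_contra hlt
      exact h1 (Set.mem_iUnion.2 ⟨a, (not_le.1 hlt).le⟩)
    have hsph : inWeight wm (sphere (graph ω) y h) ≤ Y := by
      refine (inWeight_sphere_le hL (A := 2 * M₁ ^ 2 * L) ?_ hB0.le (hB y) (h := h)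
        (fun k hk => (not_le.1 (h2 (y, ⟨k, hk⟩))).le) h le_rfl).trans hYB
      have : 1 ≤ M₁ ^ 2 := one_le_pow₀ hM1
      nlinarith
    have hr' : ∀ a, (outDeg (graph ω) a : ℝ) ≤
        r * outDeg (cut (graph ω) (sphere (graph ω) y h)) a := by
      intro a
      refine outDeg_le_mul_outDeg_cut hr hrd (hdeg' a) ?_
      by_contra hlt
      exact h3 (y, a) ⟨hsph, (not_le.1 hlt).le⟩
    have hr0 : 0 ≤ r := by linarith
    have hnice := niceProb_le (s := s) (h := h) (θ := θ) (C := C) (x := x) (htie x) hr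
      (hrh.trans (by linarith)) hr'
    have h5' := h5 (x, y)
    have h4' := h4 x
    rw [hE5, Set.mem_ofPred_eq, not_le] at h5'
    rw [hE4, Set.mem_ofPred_eq, not_le] at h4'
    set R := ∑ u ∈ bottom (graph ω) s θ (tie x) x, min (treeMass (graph ω) s θ (tie x) x u) β *
          (meanDeg wp wm u / outDeg (graph ω) u) with hR
    have hratio := cutRatio_le (θ := θ) (x := x) hp hm (htie x) hd hdeg' hβ hr0 hr'
    have hpi := piTilde_cut_le hm hr0 hr' h y
    have hpi0 := piTilde_nonneg hm (graph ω) h y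
    have hpi0' := piTilde_nonneg hm (cut (graph ω) (sphere (graph ω) y h)) h y
    have hedge : (∑ e ∈ bottom (graph ω) s θ (tie x) x ×ˢ sphere (graph ω) y h,
        if (graph ω).Adj e.1 e.2 then truncWeight (graph ω) s h θ (tie x) x y b e.1 e.2 else 0)
        ≤ ∑ e ∈ bottom (graph ω) s θ (tie x) x ×ˢ sphere (graph ω) y h,
          if ω e then truncWeight (graph ω) s h θ (tie x) x y b e.1 e.2 else 0 := by
      refine Finset.sum_le_sum fun e _ => ?_
      by_cases hadj : (graph ω).Adj e.1 e.2
      · rw [if_pos hadj, if_pos hadj.2]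
      · rw [if_neg hadj]
        split_ifs
        · exact truncWeight_nonneg _ _ _ _
        · exact le_rfl
    calc niceProb (graph ω) s h θ C (tie x) x y
        ≤ (1 + δ') * (cutRatio wp wm (graph ω) s h θ (tie x) x y *
          piTilde wm (cut (graph ω) (sphere (graph ω) y h)) h y) + δ / n :=
          (hnice.trans hedge).trans h5'.le
      _ ≤ (1 + δ') * ((r * ((1 + δ') ^ 2 + δ')) * (r ^ h * piTilde wm (graph ω) h y)) + δ / n := by
          have h6 : cutRatio wp wm (graph ω) s h θ (tie x) x y ≤ r * ((1 + δ') ^ 2 + δ') :=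
            hratio.trans (mul_le_mul_of_nonneg_left h4'.le hr0)
          have h7 := mul_le_mul h6 hpi hpi0' (by positivity)
          have := mul_le_mul_of_nonneg_left h7 (by linarith : 0 ≤ 1 + δ')
          linarith
      _ = ((1 + δ') * r ^ (h + 1) * ((1 + δ') ^ 2 + δ')) * piTilde wm (graph ω) h y + δ / n := by
          ring
      _ ≤ (1 + δ) * piTilde wm (graph ω) h y + δ / n := by
          have h8 : (1 + δ') * r ^ (h + 1) * ((1 + δ') ^ 2 + δ')
              ≤ (1 + δ') ^ 2 * ((1 + δ') ^ 2 + δ') := by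
            rw [sq (1 + δ')]
            gcongr
          have h9 := mul_le_mul_of_nonneg_right (h8.trans hδδ') hpi0
          linarith
  refine (prob_mono hpr hcover).trans ?_
  refine (prob_union_le hpr _ _).trans (add_le_add ?_ ?_)
  · refine (prob_union_le hpr _ _).trans (add_le_add ?_ ?_)
    · refine (prob_union_le hpr _ _).trans (add_le_add ?_ ?_)
      · refine (prob_union_le hpr _ _).trans (add_le_add hdeg ?_)
        have := prob_iUnion_le_card_mul hpr E2 (b := Real.exp (-L ^ 2))
          fun i => prob_sphere_growth hp hm hM hW hB0 hB rfl i.1 i.2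
        simpa using this
      · have := prob_iUnion_le_card_mul hpr E3 (b := Real.exp (-(κ * K - 1)))
          fun i => prob_card_adj_sphere_ge hp hm hM hκ hY i.1 i.2 h
        simpa using this
    · have := prob_iUnion_le_card_mul hpr E4 (b := Real.exp (-(δ' ^ 2 / (β * (M₁ ^ 2 * L)))))
        fun x => prob_sum_inv_deg_ge hp hm (by positivity) hβ0 hmean hδ'0 hδ'1 hexp (htie x) x
      simpa using this
  · have := prob_iUnion_le_card_mul hpr E5 (b := Real.exp (-(δ' / b * (δ / n))))
      fun i => prob_crossing_ge hp hm hb0 hδ'0 hδ'1 (htie i.1) i.1 i.2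
    simpa using this

end FixedSize

/-! ### Large `n` -/

section Large

variable {n : ℕ} {wp wm : Fin n → ℝ}

lemma eventually_mul_pow_le_exp (C : ℝ) (k : ℕ) {a : ℝ} (ha : 0 < a) :
    ∀ᶠ L : ℝ in atTop, C * L ^ k ≤ Real.exp (a * L) := by
  filter_upwards [((isLittleO_pow_exp_pos_mul_atTop k ha).const_mul_left C).bound one_pos] with L h
  rw [one_mul, Real.norm_eq_abs, Real.norm_eq_abs, abs_of_pos (Real.exp_pos _)] at h
  exact (le_abs_self _).trans h

lemma wm_le_mul_sqrt {M₂ η : ℝ} (hm : ∀ x, 0 < wm x) (hM₂ : 0 < M₂) (hη : 0 < η) (hn : 0 < n)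
    (hmom : ∑ x, wm x ^ (2 + η) ≤ M₂ * n) (x : Fin n) : wm x ≤ (1 + M₂) * √n := by
  have hn1 : (1 : ℝ) ≤ n := by exact_mod_cast hn
  rcases le_total (wm x) 1 with h | h
  · exact h.trans (one_le_mul_of_one_le_of_one_le (by linarith) (Real.one_le_sqrt.2 hn1))
  · have h1 : wm x ^ 2 ≤ M₂ * n := by
      calc wm x ^ 2 = wm x ^ (2 : ℝ) := (Real.rpow_two _).symm
        _ ≤ wm x ^ (2 + η) := Real.rpow_le_rpow_of_exponent_le h (by linarith)
        _ ≤ ∑ x, wm x ^ (2 + η) :=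
            Finset.single_le_sum (f := fun x => wm x ^ (2 + η))
              (fun z _ => Real.rpow_nonneg (hm z).le _) (Finset.mem_univ x)
        _ ≤ M₂ * n := hmom
    refine abs_le_of_sq_le_sq' ?_ (by positivity) |>.2
    rw [mul_pow, Real.sq_sqrt (by linarith)]
    nlinarith

lemma le_sum_erase_edgeProb {δ : ℝ} (hp : ∀ x, 0 ≤ wp x) (x : Fin n)
    (h1 : ∀ y, wp x * wm y * (Real.log n / n) ≤ 1) (hx : wm x ≤ δ * ∑ z, wm z) :
    (1 - δ) * meanDeg wp wm x ≤ ∑ y ∈ Finset.univ.erase x, edgeProb wp wm x y := by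
  have h2 : ∑ y ∈ Finset.univ.erase x, edgeProb wp wm x y
      = wp x * (Real.log n / n) * (∑ z, wm z - wm x) := by
    rw [← Finset.sum_erase_eq_sub (Finset.mem_univ x), Finset.mul_sum]
    refine Finset.sum_congr rfl fun y _ => ?_
    rw [edgeProb, min_eq_left (h1 y)]
    ring
  have h3 : 0 ≤ wp x * (Real.log n / n) := mul_nonneg (hp x) (log_div_nonneg n)
  rw [h2, meanDeg]
  calc (1 - δ) * (wp x * (∑ z, wm z) * (Real.log n / n))
      = wp x * (Real.log n / n) * (∑ z, wm z - δ * ∑ z, wm z) := by ring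
    _ ≤ _ := by gcongr

lemma hSteps_le {ε : ℝ} (hε0 : 0 < ε) (hε1 : ε < 1) (hL : 0 < Real.log n)
    (hl : 0 < Real.log (Real.log n))
    (hH : 2 / 5 * Real.log (Real.log n) ≤ entropy wp wm) :
    (hSteps wp wm ε : ℝ) ≤ Real.log n / (8 * Real.log (Real.log n)) := by
  have hH0 : 0 < entropy wp wm := by linarith
  refine (Nat.floor_le (by positivity)).trans ?_
  rw [div_le_div_iff₀ (by positivity) (by positivity)]
  have h1 : ε * Real.log n ≤ Real.log n := by nlinarith
  calc ε * Real.log n * (8 * Real.log (Real.log n))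
      ≤ Real.log n * (8 * Real.log (Real.log n)) := by gcongr
    _ ≤ Real.log n * (20 * entropy wp wm) :=
        mul_le_mul_of_nonneg_left (by linarith) hL.le

lemma four_le_sSteps {ε : ℝ} (hε1 : ε < 1) (hH0 : 0 < entropy wp wm)
    (hH : entropy wp wm ≤ Real.log n / 10) : 4 ≤ sSteps wp wm (ε / 80) := by
  refine Nat.le_floor ?_
  have h1 : 10 ≤ tEnt wp wm := by
    rw [tEnt, le_div_iff₀ hH0]
    linarith
  push_cast
  nlinarith

/-- Room for the errors of the successive approximations. -/
lemma exists_error {δ : ℝ} (hδ : 0 < δ) : ∃ δ' : ℝ, 0 < δ' ∧ δ' ≤ 1 ∧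
    (1 + δ') ^ 2 * ((1 + δ') ^ 2 + δ') ≤ 1 + δ := by
  refine ⟨min 1 (δ / 20), by positivity, min_le_left _ _, ?_⟩
  have h1 : min 1 (δ / 20) ≤ 1 := min_le_left _ _
  have h2 : min 1 (δ / 20) ≤ δ / 20 := min_le_right _ _
  have h0 : 0 < min 1 (δ / 20) := by positivity
  set t := min 1 (δ / 20)
  have h3 : t ^ 2 ≤ t := by nlinarith
  have h4 : t ^ 3 ≤ t := by nlinarith
  have h5 : t ^ 4 ≤ t := by nlinarith
  nlinarith

/-- Room for a loss in the means of the out-degrees. -/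
lemma exists_loss {M₀ δ : ℝ} (hM₀ : 1 < M₀) (hδ0 : 0 < δ) (hδ1 : δ ≤ 1) : ∃ δ₁ : ℝ,
    0 < δ₁ ∧ δ₁ < 1 ∧ 1 ≤ (1 - δ₁) * M₀ ∧ 1 / (1 - δ₁) ^ 2 ≤ 1 + δ / 2 := by
  have hM : 0 < (M₀ - 1) / M₀ := div_pos (by linarith) (by linarith)
  have h1 : min (δ / 8) ((M₀ - 1) / M₀) ≤ δ / 8 := min_le_left _ _
  have h0 : 0 < min (δ / 8) ((M₀ - 1) / M₀) := by positivity
  have h2 : min (δ / 8) ((M₀ - 1) / M₀) ≤ (M₀ - 1) / M₀ := min_le_right _ _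
  rw [le_div_iff₀ (by linarith)] at h2
  refine ⟨min (δ / 8) ((M₀ - 1) / M₀), h0, by linarith, by linarith, ?_⟩
  set t := min (δ / 8) ((M₀ - 1) / M₀)
  have ht1 : t ≤ 1 / 8 := by linarith
  have h3 : 0 < (1 - t) ^ 2 := by
    have : 0 < 1 - t := by linarith
    positivity
  have h4 : 1 / (1 - t) ^ 2 ≤ 1 + 4 * t := by
    rw [div_le_iff₀ h3]
    nlinarith [mul_pos h0 h0]
  linarith

/-- Parameters for the lower tail of the out-degrees: a mean of at least `M₀ log n` with `M₀ > 1`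
makes the probability of an out-degree below `c log n` smaller than `1 / n`. -/
lemma exists_degree_constants {M₀ : ℝ} (hM₀ : 1 < M₀) : ∃ θ c : ℝ, 0 < θ ∧ 0 < c ∧
    Real.exp (-θ) < 1 ∧ M₀ * (1 - Real.exp (-θ)) - θ * c = 1 + (M₀ - 1) / 2 := by
  set q : ℝ := (M₀ - 1) / (4 * M₀) with hq
  have hq0 : 0 < q := div_pos (by linarith) (by linarith)
  have hq1 : q < 1 := by
    rw [hq, div_lt_one (by linarith)]
    linarith
  have hθ : 0 < -Real.log q := neg_pos.2 (Real.log_neg hq0 hq1)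
  refine ⟨-Real.log q, (M₀ - 1) / (4 * -Real.log q), hθ, div_pos (by linarith) (by linarith),
    ?_, ?_⟩
  · rwa [neg_neg, Real.exp_log hq0]
  · rw [neg_neg, Real.exp_log hq0]
    have h1 : -Real.log q * ((M₀ - 1) / (4 * -Real.log q)) = (M₀ - 1) / 4 := by
      rw [mul_comm 4, ← mul_div_assoc, mul_div_mul_left _ _ hθ.ne']
    have h2 : M₀ * q = (M₀ - 1) / 4 := by
      rw [hq]
      field_simp
    rw [h1]
    linarith

/-- The in-weight of the spheres of radius `h` is at most `n ^ (4 / 5)`. -/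
lemma growth_le {A₀ A L : ℝ} {h : ℕ} (hA0 : 0 < A) (hA : 4 * A ≤ L) (hL : 1 ≤ L)
    (hA₀ : A₀ * L ^ 2 ≤ Real.exp (1 / 20 * L)) (hh : (h : ℝ) * Real.log L ≤ L / 8) :
    A₀ * Real.exp (1 / 2 * L) * L ^ 2 * (2 * (2 * A * L)) ^ h ≤ Real.exp (4 / 5 * L) := by
  have hL0 : 0 < L := by linarith
  have h1 : 2 * (2 * A * L) ≤ L ^ 2 := by nlinarith
  have h2 : (2 * (2 * A * L)) ^ h ≤ Real.exp (1 / 4 * L) := by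
    refine (pow_le_pow_left₀ (by positivity) h1 h).trans ?_
    rw [← Real.exp_log (by positivity : 0 < (L ^ 2) ^ h), Real.log_pow, Real.log_pow]
    refine Real.exp_le_exp.2 ?_
    push_cast
    linarith
  calc A₀ * Real.exp (1 / 2 * L) * L ^ 2 * (2 * (2 * A * L)) ^ h
      = (A₀ * L ^ 2) * (Real.exp (1 / 2 * L) * (2 * (2 * A * L)) ^ h) := by ring
    _ ≤ Real.exp (1 / 20 * L) * (Real.exp (1 / 2 * L) * Real.exp (1 / 4 * L)) := by gcongr
    _ = Real.exp (4 / 5 * L) := by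
        rw [← Real.exp_add, ← Real.exp_add]
        congr 1; ring

lemma sphere_edges_le {M L : ℝ} (h : M * L ≤ Real.exp (1 / 10 * L)) :
    Real.exp (1 / 10 * L) * (M * (L / Real.exp L) * Real.exp (4 / 5 * L)) ≤ 1 :=
  calc Real.exp (1 / 10 * L) * (M * (L / Real.exp L) * Real.exp (4 / 5 * L))
      = Real.exp (1 / 10 * L) * (M * L) * Real.exp (4 / 5 * L) / Real.exp L := by ring
    _ ≤ Real.exp (1 / 10 * L) * Real.exp (1 / 10 * L) * Real.exp (4 / 5 * L) / Real.exp L := by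
        gcongr
    _ = 1 := by
        rw [← Real.exp_add, ← Real.exp_add, ← Real.exp_sub, Real.exp_eq_one_iff]
        ring

/-- A change of the out-degrees by a bounded number of edges is invisible after `h` steps, as
`h = o(log n)`. -/
lemma degree_ratio_pow_le {c δ L : ℝ} {h : ℕ} (hc : 0 < c) (hδ : 0 < δ) (hL : 0 < L)
    (h1 : 80 / c / (Real.log (1 + δ) / 2) ≤ L)
    (h2 : 10 / c / (Real.log (1 + δ) / 2) ≤ Real.log L)
    (hh : (h : ℝ) * Real.log L ≤ L / 8) : (1 + 80 / (c * L)) ^ (h + 1) ≤ 1 + δ := by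
  set ℓ : ℝ := Real.log (1 + δ) with hℓ
  have hℓ0 : 0 < ℓ := Real.log_pos (by linarith)
  rw [div_le_iff₀ (by positivity)] at h1 h2
  have h5 : (h : ℝ) * (80 / (c * L)) ≤ ℓ / 2 := by
    calc (h : ℝ) * (80 / (c * L)) = (h : ℝ) * 8 / L * (10 / c) := by field_simp; ring
      _ ≤ (h : ℝ) * 8 / L * (Real.log L * (ℓ / 2)) := by gcongr
      _ = ((h : ℝ) * Real.log L) * (8 / L * (ℓ / 2)) := by ring
      _ ≤ (L / 8) * (8 / L * (ℓ / 2)) := by gcongr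
      _ = ℓ / 2 := by field_simp
  have h6 : 80 / (c * L) ≤ ℓ / 2 := by
    rw [← div_div, div_le_iff₀ hL]
    linarith
  have h7 : 1 + 80 / (c * L) ≤ Real.exp (80 / (c * L)) := by
    linarith [Real.add_one_le_exp (80 / (c * L))]
  calc (1 + 80 / (c * L)) ^ (h + 1) ≤ Real.exp (80 / (c * L)) ^ (h + 1) := by gcongr
    _ = Real.exp (((h + 1 : ℕ) : ℝ) * (80 / (c * L))) := (Real.exp_nat_mul _ _).symm
    _ ≤ Real.exp ℓ := by
        refine Real.exp_le_exp.2 ?_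
        push_cast
        linarith
    _ = 1 + δ := Real.exp_log (by linarith)

lemma inv_pow_le {c L : ℝ} {s : ℕ} (hc : 0 < c) (hL : 0 < L) (hcL : 1 ≤ c * L)
    (h : 1 / c ^ 4 ≤ L) (hs : 4 ≤ s) : (1 / (c * L)) ^ s ≤ 1 / L ^ 3 :=
  calc (1 / (c * L)) ^ s ≤ (1 / (c * L)) ^ 4 :=
        pow_le_pow_of_le_one (by positivity) ((div_le_one (by positivity)).2 hcL) hs
    _ = (1 / c ^ 4) / L ^ 4 := by rw [div_pow, mul_pow, one_pow, div_div]
    _ ≤ L / L ^ 4 := by gcongr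
    _ = 1 / L ^ 3 := by field_simp

lemma mul_exp_neg_le {l M c δ L : ℝ} (hc : 0 < c) (hL : 0 ≤ L) (h1 : L ≤ l) (h2 : l ≤ M * L)
    (hδ : 0 < δ) (h : M / δ * L ≤ Real.exp (c * L)) : l * Real.exp (-(c * l)) ≤ δ := by
  have h3 : M * L ≤ δ * Real.exp (c * L) := by
    rw [div_mul_eq_mul_div, div_le_iff₀ hδ] at h
    linarith
  calc l * Real.exp (-(c * l)) ≤ (M * L) * Real.exp (-(c * L)) :=
        mul_le_mul h2 (Real.exp_le_exp.2 (neg_le_neg (mul_le_mul_of_nonneg_left h1 hc.le)))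
          (Real.exp_pos _).le (by linarith)
    _ ≤ (δ * Real.exp (c * L)) * Real.exp (-(c * L)) :=
        mul_le_mul_of_nonneg_right h3 (Real.exp_pos _).le
    _ = δ := by rw [mul_assoc, ← Real.exp_add, add_neg_cancel, Real.exp_zero, mul_one]

/-- The sum of the error probabilities, written in terms of `N = n` and `L = log n`. -/
lemma error_sum_le {a δ' δ M L N h : ℝ} (hL : 3 ≤ L) (hN : Real.exp L = N)
    (hh : h ≤ L) (hδ'0 : 0 < δ') (hδ0 : 0 < δ) (hM : 0 < M)
    (h1 : 2 * M / δ' ^ 2 ≤ L) (h2 : 6 / (δ' * δ) ≤ L) :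
    N * Real.exp (-((1 + a) * L)) + N * h * Real.exp (-L ^ 2)
        + N * N * Real.exp (-(1 / 10 * L * 40 - 1))
        + N * Real.exp (-(δ' ^ 2 / (1 / L ^ 3 * (M * L))))
        + N * N * Real.exp (-(δ' / (2 / (N * L ^ 3)) * (δ / N)))
      ≤ Real.exp (-(a * L)) + 4 * Real.exp (1 - L) := by
  have hL0 : 0 < L := by linarith
  have hN0 : 0 < N := hN ▸ Real.exp_pos L
  have t1 : N * Real.exp (-((1 + a) * L)) = Real.exp (-(a * L)) := by
    rw [← hN, ← Real.exp_add]
    congr 1; ring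
  have t2 : N * h * Real.exp (-L ^ 2) ≤ Real.exp (1 - L) := by
    calc N * h * Real.exp (-L ^ 2) ≤ Real.exp L * Real.exp L * Real.exp (-L ^ 2) := by
          rw [← hN]
          have : h ≤ Real.exp L := by linarith [Real.add_one_le_exp L]
          gcongr
      _ = Real.exp (L + L + -L ^ 2) := by rw [← Real.exp_add, ← Real.exp_add]
      _ ≤ Real.exp (1 - L) := Real.exp_le_exp.2 (by nlinarith)
  have t3 : N * N * Real.exp (-(1 / 10 * L * 40 - 1)) ≤ Real.exp (1 - L) := by
    rw [← hN, ← Real.exp_add, ← Real.exp_add]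
    exact Real.exp_le_exp.2 (by linarith)
  have t4 : N * Real.exp (-(δ' ^ 2 / (1 / L ^ 3 * (M * L)))) ≤ Real.exp (1 - L) := by
    have h3 : δ' ^ 2 / (1 / L ^ 3 * (M * L)) = δ' ^ 2 / M * L * L := by
      field_simp
    have h4 : 2 ≤ δ' ^ 2 / M * L := by
      rw [div_le_iff₀ (by positivity)] at h1
      rw [div_mul_eq_mul_div, le_div_iff₀ hM]
      linarith
    have h5 := mul_le_mul_of_nonneg_right h4 hL0.le
    rw [h3, ← hN, ← Real.exp_add]
    exact Real.exp_le_exp.2 (by linarith)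
  have t5 : N * N * Real.exp (-(δ' / (2 / (N * L ^ 3)) * (δ / N))) ≤ Real.exp (1 - L) := by
    have h3 : δ' / (2 / (N * L ^ 3)) * (δ / N) = δ' * δ * L / 2 * L ^ 2 := by
      field_simp
    have h4 : 3 ≤ δ' * δ * L / 2 := by
      rw [div_le_iff₀ (by positivity)] at h2
      linarith
    have h5 : L ≤ L ^ 2 := by nlinarith
    have h6 := mul_le_mul h4 h5 hL0.le (by linarith)
    rw [h3, ← hN, ← Real.exp_add, ← Real.exp_add]
    exact Real.exp_le_exp.2 (by linarith)
  linarith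

lemma meanDeg_le {M₁ : ℝ} (hp : ∀ x, 0 ≤ wp x) (hM : ∀ x, wp x ≤ M₁) (hn : 0 < n)
    (hW : ∑ z, wm z ≤ M₁ * n) (hW0 : 0 ≤ ∑ z, wm z) (x : Fin n) :
    meanDeg wp wm x ≤ M₁ ^ 2 * Real.log n := by
  have hn0 : (0 : ℝ) < n := by exact_mod_cast hn
  have h0 := log_div_nonneg n
  have h1 := hM x
  have h2 : 0 ≤ M₁ := (hp x).trans h1
  calc meanDeg wp wm x ≤ M₁ * (M₁ * n) * (Real.log n / n) := by
        rw [meanDeg]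
        gcongr
    _ = M₁ ^ 2 * Real.log n := by field_simp

lemma le_meanDeg {M₀ : ℝ} (hM₀ : 0 ≤ M₀) (hM : ∀ x, M₀ ≤ wp x) (hn : 0 < n)
    (hW : M₀ * n ≤ ∑ z, wm z) (x : Fin n) : M₀ ^ 2 * Real.log n ≤ meanDeg wp wm x := by
  have hn0 : (0 : ℝ) < n := by exact_mod_cast hn
  have h0 := log_div_nonneg n
  have h1 := hM x
  have h2 : 0 ≤ wp x := hM₀.trans h1
  calc M₀ ^ 2 * Real.log n = M₀ * (M₀ * n) * (Real.log n / n) := by field_simp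
    _ ≤ meanDeg wp wm x := by
        rw [meanDeg]
        gcongr

/-- No edge probability is truncated at `1`, and no single vertex matters for the mean degrees,
because the in-weights are of order at most `√n`. -/
lemma le_sum_erase_edgeProb_of_sqrt {M₀ M₁ A δ : ℝ} (hp : ∀ x, 0 ≤ wp x) (hM : ∀ x, wp x ≤ M₁)
    (hm : ∀ x, 0 < wm x) (hn : 0 < n) (hM₀ : 0 < M₀) (hW : M₀ * n ≤ ∑ z, wm z) (hδ : 0 < δ)
    (hwm : ∀ x, wm x ≤ A * √n)
    (h1 : M₁ * A * Real.log n ≤ √n) (h2 : A / (δ * M₀) ≤ √n) (x : Fin n) :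
    (1 - δ) * meanDeg wp wm x ≤ ∑ y ∈ Finset.univ.erase x, edgeProb wp wm x y := by
  have hn0 : (0 : ℝ) < n := by exact_mod_cast hn
  have hsq : √(n : ℝ) * √n = n := Real.mul_self_sqrt hn0.le
  refine le_sum_erase_edgeProb hp x (fun y => ?_) ?_
  · have h3 := hM x
    have h4 := hwm y
    have h5 := hp x
    have h6 := (hm y).le
    have h7 := log_div_nonneg n
    have h8 : 0 ≤ M₁ := h5.trans h3
    calc wp x * wm y * (Real.log n / n) ≤ M₁ * (A * √n) * (Real.log n / n) := by gcongr
      _ = (M₁ * A * Real.log n) * √n / n := by ring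
      _ ≤ √n * √n / n := by gcongr
      _ = 1 := by rw [hsq, div_self hn0.ne']
  · rw [div_le_iff₀ (by positivity)] at h2
    calc wm x ≤ A * √n := hwm x
      _ ≤ √n * (δ * M₀) * √n := by gcongr
      _ = δ * (M₀ * (√n * √n)) := by ring
      _ = δ * (M₀ * n) := by rw [hsq]
      _ ≤ δ * ∑ z, wm z := by gcongr

/-- If the out-degrees typically exceed `c log n`, the entropy is at least of order
`log log n`. -/
lemma le_entropy_of_tail {c ρ : ℝ} (hp : ∀ x, 0 ≤ wp x) (hm : ∀ x, 0 < wm x) (hn : 0 < n)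
    (hc : 0 < c) (hcL : 1 ≤ c * Real.log n) (hlog : 0 ≤ Real.log (Real.log n))
    (hlc : -(5 * Real.log c) ≤ Real.log (Real.log n)) (hρ : ρ ≤ 1 / 2)
    (htail : ∀ x, prob (fun y => edgeProb wp wm x y) {r | rowDeg x r ≤ c * Real.log n} ≤ ρ) :
    2 / 5 * Real.log (Real.log n) ≤ entropy wp wm := by
  have hL0 : Real.log n ≠ 0 := by
    intro h0
    rw [h0, mul_zero] at hcL
    linarith
  have h1 := le_entropy hp hm hn hcL htail
  rw [Real.log_mul hc.ne' hL0] at h1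
  refine le_trans ?_ h1
  have h3 : 4 / 5 * Real.log (Real.log n) ≤ Real.log c + Real.log (Real.log n) := by linarith
  have h4 := mul_le_mul h3 (by linarith : 1 / 2 ≤ 1 - ρ) (by norm_num) (by linarith)
  linarith

/-- For large `n` the theorem fails with probability at most `exp (-a log n) + 4 exp (1 - log n)`,
where `a = (M₀ - 1) / 2`. -/
lemma eventually_prob_goodEvent_compl_le
    (wp wm : (n : ℕ) → Fin n → ℝ) (M₀ M₁ M₂ η : ℝ)
    (hM₀ : 1 < M₀) (hM₁ : 1 < M₁) (hM₂ : 0 < M₂) (hη₀ : 0 < η)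
    (hwm : ∀ n x, 0 < wm n x)
    (hsum : ∀ n, ∑ x, wp n x = ∑ x, wm n x)
    (hwp : ∀ n x, M₀ ≤ wp n x ∧ wp n x ≤ M₁)
    (hmom : ∀ n : ℕ, ∑ x, wm n x ^ (2 + η) ≤ M₂ * n)
    (ε : ℝ) (hε₀ : 0 < ε) (hε₁ : ε < 1) (C : ℝ)
    (tie : (n : ℕ) → Fin n → Finset (Fin n × Fin n) → Fin n × Fin n)
    (htie : ∀ n x S, S.Nonempty → tie n x S ∈ S)
    (δ : ℝ) (hδ : 0 < δ) :
    ∀ᶠ n : ℕ in atTop, prob (fun e => edgeProb (wp n) (wm n) e.1 e.2)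
        (goodEvent (wp n) (wm n) ε C δ (tie n))ᶜ
      ≤ Real.exp (-((M₀ - 1) / 2 * Real.log n)) + 4 * Real.exp (1 - Real.log n) := by
  obtain ⟨δ', hδ'0, hδ'1, hδ'⟩ := exists_error hδ
  obtain ⟨δ₁, hδ₁0, hδ₁1, hδ₁M, hδ₁⟩ := exists_loss hM₀ hδ'0 hδ'1
  obtain ⟨θ₀, c, hθ₀, hc, hθ₁, hθc⟩ := exists_degree_constants hM₀
  have hM₁0 : 0 < M₁ := by linarith
  have hc₁ : 0 < δ₁ ^ 2 * (1 - δ₁) / 4 := by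
    have : 0 < 1 - δ₁ := by linarith
    positivity
  -- the coefficient of the linear bound on the logarithm in `entropy_le`
  obtain ⟨κ, hκ0, hκ⟩ : ∃ κ : ℝ, 0 < κ ∧ κ * M₁ ^ 2 = 1 / 20 :=
    ⟨1 / (20 * M₁ ^ 2), by positivity, by field_simp⟩
  have hlog : Tendsto (fun n : ℕ => Real.log n) atTop atTop :=
    Real.tendsto_log_atTop.comp tendsto_natCast_atTop_atTop
  filter_upwards [eventually_gt_atTop 0,
    hlog.eventually (eventually_mul_pow_le_exp (M₁ * (1 + M₂)) 1 (a := 1 / 2) (by norm_num)),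
    hlog.eventually (eventually_mul_pow_le_exp ((1 + M₂) / (δ₁ * M₀)) 0 (a := 1 / 2)
      (by norm_num)),
    hlog.eventually (eventually_mul_pow_le_exp (1 + M₂) 2 (a := 1 / 20) (by norm_num)),
    hlog.eventually (eventually_mul_pow_le_exp M₁ 1 (a := 1 / 10) (by norm_num)),
    hlog.eventually (eventually_mul_pow_le_exp (M₁ ^ 2 / (δ' / 2)) 1 hc₁),
    hlog.eventually (eventually_ge_atTop 3),
    hlog.eventually (eventually_ge_atTop (80 / c)),
    hlog.eventually (eventually_ge_atTop (1 / c ^ 4)),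
    hlog.eventually (eventually_ge_atTop (4 * M₁ ^ 2)),
    hlog.eventually (eventually_ge_atTop (80 / c / (Real.log (1 + δ') / 2))),
    hlog.eventually (eventually_ge_atTop (20 * (κ - Real.log κ))),
    hlog.eventually (eventually_ge_atTop (2 * M₁ ^ 2 / δ' ^ 2)),
    hlog.eventually (eventually_ge_atTop (6 / (δ' * δ))),
    (Real.tendsto_log_atTop.comp hlog).eventually (eventually_ge_atTop (-(5 * Real.log c))),
    (Real.tendsto_log_atTop.comp hlog).eventually
      (eventually_ge_atTop (10 / c / (Real.log (1 + δ') / 2)))]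
    with n hn e1 e2 e3 e4 e5 e6 e7 e8 e9 e10 e11 e12 e13 e14 e15
  have hp : ∀ x, 0 ≤ wp n x := fun x => le_trans (by linarith) (hwp n x).1
  have hm := hwm n
  have hn0 : (0 : ℝ) < n := by exact_mod_cast hn
  have hL0 : 0 < Real.log n := by linarith only [e6]
  have hlogL : 1 ≤ Real.log (Real.log n) := by
    rw [Real.le_log_iff_exp_le hL0]
    linarith only [Real.exp_one_lt_d9, e6]
  have hexpL : Real.exp (Real.log n) = n := Real.exp_log hn0
  have hsqrt : Real.exp (1 / 2 * Real.log n) = √(n : ℝ) := by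
    rw [← hexpL, ← Real.exp_half, hexpL]
    congr 1; ring
  rw [hsqrt, pow_one] at e1
  rw [hsqrt, pow_zero, mul_one] at e2
  rw [pow_one] at e4 e5
  have hwB := wm_le_mul_sqrt hm hM₂ hη₀ hn (hmom n)
  have hWlow : M₀ * n ≤ ∑ z, wm n z := by
    rw [← hsum n]
    calc M₀ * n = ∑ _x : Fin n, M₀ := by simp [mul_comm]
      _ ≤ _ := Finset.sum_le_sum fun x _ => (hwp n x).1
  have hWup : ∑ z, wm n z ≤ M₁ * n := by
    rw [← hsum n]
    calc _ ≤ ∑ _x : Fin n, M₁ := Finset.sum_le_sum fun x _ => (hwp n x).2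
      _ = M₁ * n := by simp [mul_comm]
  have hmean := meanDeg_le hp (fun x => (hwp n x).2) hn hWup
    (Finset.sum_nonneg fun z _ => (hm z).le)
  have hmean' := le_meanDeg (by linarith only [hM₀]) (fun x => (hwp n x).1) hn hWlow
  have hsumE := le_sum_erase_edgeProb_of_sqrt hp (fun x => (hwp n x).2) hm hn
    (by linarith only [hM₀]) hWlow hδ₁0 hwB e1 e2
  have hsumE' : ∀ x, M₀ * Real.log n
      ≤ ∑ y ∈ Finset.univ.erase x, edgeProb (wp n) (wm n) x y := fun x =>
    calc M₀ * Real.log n ≤ ((1 - δ₁) * M₀) * (M₀ * Real.log n) :=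
          le_mul_of_one_le_left (mul_nonneg (by linarith only [hM₀]) hL0.le) hδ₁M
      _ = (1 - δ₁) * (M₀ ^ 2 * Real.log n) := by ring
      _ ≤ (1 - δ₁) * meanDeg (wp n) (wm n) x :=
          mul_le_mul_of_nonneg_left (hmean' x) (by linarith only [hδ₁1])
      _ ≤ _ := hsumE x
  have htail : ∀ x, (1 + (M₀ - 1) / 2) * Real.log n ≤
      (∑ y ∈ Finset.univ.erase x, edgeProb (wp n) (wm n) x y) * (1 - Real.exp (-θ₀))
        - θ₀ * (c * Real.log n) := by
    intro x
    have h1 := mul_le_mul_of_nonneg_right (hsumE' x)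
      (by linarith only [hθ₁] : 0 ≤ 1 - Real.exp (-θ₀))
    have h2 : (1 + (M₀ - 1) / 2) * Real.log n
        = M₀ * Real.log n * (1 - Real.exp (-θ₀)) - θ₀ * (c * Real.log n) := by
      rw [← hθc]; ring
    linarith only [h1, h2]
  have hcL : 80 ≤ c * Real.log n := by
    rw [div_le_iff₀ hc] at e7
    linarith only [e7]
  have hcL0 : 0 < c * Real.log n := mul_pos hc hL0
  have hρ : Real.exp (-((1 + (M₀ - 1) / 2) * Real.log n)) ≤ 1 / 2 := by
    have h3 : -((1 + (M₀ - 1) / 2) * Real.log n) ≤ -1 := by nlinarith only [e6, hM₀]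
    refine (Real.exp_le_exp.2 h3).trans ?_
    rw [Real.exp_neg, one_div]
    exact inv_anti₀ (by norm_num) (by linarith only [Real.add_one_le_exp 1])
  have hHlow := le_entropy_of_tail hp hm hn hc (by linarith only [hcL]) (by linarith only [hlogL])
    e14 hρ (fun x => prob_rowDeg_le hp hm x hθ₀ (htail x))
  have hHup : entropy (wp n) (wm n) ≤ Real.log n / 10 := by
    have h1 := entropy_le hp hm hn hκ0 hmean
    have h2 : κ * (1 + M₁ ^ 2 * Real.log n) = κ + Real.log n / 20 := by
      rw [mul_add, ← mul_assoc, hκ]; ring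
    linarith only [h1, h2, e11]
  have hh := hSteps_le (ε := ε) hε₀ hε₁ hL0 (by linarith only [hlogL]) hHlow
  have hs : 4 ≤ sSteps (wp n) (wm n) (ε / 80) :=
    four_le_sSteps hε₁ (by linarith only [hHlow, hlogL]) hHup
  have hhL : (hSteps (wp n) (wm n) ε : ℝ) * Real.log (Real.log n) ≤ Real.log n / 8 := by
    rw [le_div_iff₀ (by linarith only [hlogL])] at hh
    linarith only [hh]
  have hhL' : (hSteps (wp n) (wm n) ε : ℝ) ≤ Real.log n :=
    hh.trans (div_le_self hL0.le (by linarith only [hlogL]))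
  have hgrow := growth_le (h := hSteps (wp n) (wm n) ε) (pow_pos hM₁0 2) e9
    (by linarith only [e6]) e3 hhL
  rw [hsqrt] at hgrow
  have hedges := sphere_edges_le e4
  rw [hexpL] at hedges
  -- fewer than `40` edges from any vertex into a sphere
  have hr1 : 1 ≤ 1 + 80 / (c * Real.log n) := le_add_of_nonneg_right (by positivity)
  have hrd : (1 + 80 / (c * Real.log n)) * 40
      ≤ (1 + 80 / (c * Real.log n) - 1) * (c * Real.log n) := by
    have h1 : 80 / (c * Real.log n) ≤ 1 := (div_le_one hcL0).2 hcL
    rw [add_sub_cancel_left, div_mul_cancel₀ _ hcL0.ne']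
    linarith only [h1]
  have hrh := degree_ratio_pow_le hc hδ'0 hL0 e10 e15 hhL
  have hβ := inv_pow_le hc hL0 (by linarith only [hcL]) e8 hs
  have hexp : ∀ x, expect (fun y => edgeProb (wp n) (wm n) x y)
      (fun r => meanDeg (wp n) (wm n) x / rowDeg x r) ≤ 1 + δ' := by
    intro x
    have h1 := expect_inv_rowDeg_le hp hm x hδ₁0 hδ₁1 (hsumE x)
    have h2 : Real.log n ≤ meanDeg (wp n) (wm n) x :=
      (le_mul_of_one_le_left hL0.le (one_le_pow₀ hM₀.le)).trans (hmean' x)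
    have h3 := mul_exp_neg_le hc₁ hL0.le h2 (hmean x) (half_pos hδ'0) e5
    linarith only [h1, h3, hδ₁]
  refine (prob_goodEvent_compl_le (htie n) rfl rfl rfl hp hm hn (by linarith only [e6]) hM₁.le
    (fun x => (hwp n x).2) hWup (by positivity) hwB hcL0
    (prob_exists_outDeg_le hp hm hθ₀ htail) hgrow (by positivity) hedges hr1 hrd hrh
    (by positivity) hβ hmean hδ'0 hδ'1 hexp hδ').trans ?_
  exact error_sum_le e6 hexpL hhL' hδ'0 hδ (pow_pos hM₁0 2) e12 e13

end Large

end ChungLu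

end

theorem proposition5p4
    (wp wm : (n : ℕ) → Fin n → ℝ) (M₀ M₁ M₂ η : ℝ)
    (hM₀ : 1 < M₀) (hM₁ : 1 < M₁) (hM₂ : 0 < M₂) (hη₀ : 0 < η) (hη₁ : η < 1)
    (hwm : ∀ n x, 0 < wm n x)
    (hsum : ∀ n, ∑ x, wp n x = ∑ x, wm n x)
    (hwp : ∀ n x, M₀ ≤ wp n x ∧ wp n x ≤ M₁)
    (hmom : ∀ n : ℕ, ∑ x, wm n x ^ (2 + η) ≤ M₂ * n)
    (ε : ℝ) (hε₀ : 0 < ε) (hε₁ : ε < 1)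
    (C : ℝ) (hC : 0 < C)
    (tie : (n : ℕ) → Fin n → Finset (Fin n × Fin n) → Fin n × Fin n)
    (htie : ∀ n x S, S.Nonempty → tie n x S ∈ S)
    (δ : ℝ) (hδ : 0 < δ) :
    Tendsto (fun n : ℕ => ChungLu.law (wp n) (wm n)
        (ChungLu.goodEvent (wp n) (wm n) ε C δ (tie n)))
      atTop (𝓝 1) := by
  have hlog : Tendsto (fun n : ℕ => Real.log n) atTop atTop :=
    Real.tendsto_log_atTop.comp tendsto_natCast_atTop_atTop
  have hbound : Tendsto (fun n : ℕ => Real.exp (-((M₀ - 1) / 2 * Real.log n))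
      + 4 * Real.exp (1 - Real.log n)) atTop (𝓝 0) := by
    have h1 : Tendsto (fun n : ℕ => Real.exp (-((M₀ - 1) / 2 * Real.log n))) atTop (𝓝 0) :=
      Real.tendsto_exp_neg_atTop_nhds_zero.comp (hlog.const_mul_atTop (by linarith))
    have h2 : Tendsto (fun n : ℕ => Real.exp (1 - Real.log n)) atTop (𝓝 0) :=
      Real.tendsto_exp_atBot.comp (tendsto_atBot_add_const_left _ 1
        (tendsto_neg_atTop_atBot.comp hlog))
    simpa using h1.add (h2.const_mul 4)
  have hp : ∀ n x, 0 ≤ wp n x := fun n x => by linarith [(hwp n x).1]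
  have hcompl : Tendsto (fun n : ℕ => (ChungLu.law (wp n) (wm n)).real
      (ChungLu.goodEvent (wp n) (wm n) ε C δ (tie n))ᶜ) atTop (𝓝 0) := by
    refine tendsto_of_tendsto_of_tendsto_of_le_of_le' tendsto_const_nhds hbound
      (Eventually.of_forall fun n => measureReal_nonneg) ?_
    filter_upwards [ChungLu.eventually_prob_goodEvent_compl_le wp wm M₀ M₁ M₂ η hM₀ hM₁ hM₂ hη₀
      hwm hsum hwp hmom ε hε₀ hε₁ C tie htie δ hδ] with n hn
    rw [ChungLu.law_real (hp n) (fun x => (hwm n x).le)]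
    exact hn
  have hreal : Tendsto (fun n : ℕ => (ChungLu.law (wp n) (wm n)).real
      (ChungLu.goodEvent (wp n) (wm n) ε C δ (tie n))) atTop (𝓝 1) := by
    have h1 : ∀ n, (ChungLu.law (wp n) (wm n)).real
        (ChungLu.goodEvent (wp n) (wm n) ε C δ (tie n))
        = 1 - (ChungLu.law (wp n) (wm n)).real
          (ChungLu.goodEvent (wp n) (wm n) ε C δ (tie n))ᶜ := fun n => by
      rw [probReal_compl_eq_one_sub (Set.toFinite _).measurableSet, sub_sub_cancel]
    simp only [h1]
    simpa using hcompl.const_sub 1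
  refine (ENNReal.tendsto_toReal_iff (fun n => measure_ne_top _ _) ENNReal.one_ne_top).1 ?_
  rw [ENNReal.toReal_one]
  exact hreal
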